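/- Let $\mathbb{H}=\{z\in\mathbb{C}:\operatorname{Re}z>0\}$ and let $\ell\ge 0$ be an integer. The weighted Bergman space $A^2_\ell$ is the Hilbert space of all analytic functions $h:\mathbb{H}\to\mathbb{C}$ with $$\|h\|^2=\frac1\pi\int_{-\infty}^{\infty}\int_0^\infty x^\ell\,|h(x+iy)|^2\,dx\,dy<\infty .$$ Let $f:\mathbb{H}\to\mathbb{C}$ and $g:\mathbb{H}\to\mathbb{H}$ be analytic. The maximal weighted composition operator $W_{f,g,\max}$ on $A^2_\ell$ has domain $\{h\in A^2_\ell : f\cdot(h\circ g)\in A^2_\ell\}$ and acts by $W_{f,g,\max}h=f\cdot(h\circ g)$. It is called hermitian if it is densely defined and equals its adjoint, $W_{f,g,\max}^*=W_{f,g,\max}$ (including equality of domains). **Theorem.** $W_{f,g,\max}$ is hermitian if and only if $f\equiv 0$ on $\mathbb{H}$ or one of the following holds for all $w\in\mathbb{H}$: 1. $g(w)=\mu$ and $f(w)=\dfrac{\varepsilon}{(w+\overline{\mu})^{\ell+2}}$ for some $\mu\in\mathbb{H}$ and $\varepsilon\in\mathbb{R}$; 2. $g(w)=w+\gamma$ and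 $f(w)=\lambda$ for some $\gamma\in[0,\infty)$ and $\lambda\in\mathbb{R}$; 3. $g(w)=-\dfrac{\beta}{\alpha}-\dfrac{2}{\alpha w-\overline{\beta}}$ and $f(w)=\dfrac{\delta}{(\alpha w-\overline{\beta})^{\ell+2}}$ for some $\alpha,\delta\in\mathbb{R}\setminus\{0\}$ and $\beta\in\mathbb{C}$ such that either $\operatorname{Re}\beta<0<\alpha\le\frac{(\operatorname{Re}\beta)^2}{2}$, or $\alpha<0\le\operatorname{Re}\beta$. In this case $W_{f,g,\max}$ is bounded: its domain is all of $A^2_\ell$ and there is a constant $L>0$ with $\|W_{f,g,\max}h\|\le L\|h\|$ for every $h\in A^2_\ell$. -/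

import Mathlib

open MeasureTheory Set Filter Topology
open scoped ENNReal ComplexConjugate

noncomputable section

/-- The open right half-plane `{z : 0 < Re z}`. -/
def rightHalfPlane : Set ℂ := {z : ℂ | 0 < z.re}

/-- The measure `(1/π) x ^ ℓ dx dy` on the right half-plane, as a measure on `ℂ`. -/
def bergmanMeasure (ℓ : ℕ) : Measure ℂ :=
  (volume.restrict rightHalfPlane).withDensity fun z => ENNReal.ofReal (z.re ^ ℓ / Real.pi)

/-- The holomorphic functions `h` on the right half-plane with
`(1/π) ∫∫ x ^ ℓ |h (x + i y)| ^ 2 dx dy < ∞`. A function on the half-plane is represented by its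
extension by zero to `ℂ`, so that equality of elements is equality of functions on the
half-plane. -/
def bergmanSubmodule (ℓ : ℕ) : Submodule ℂ (ℂ → ℂ) where
  carrier := {h | DifferentiableOn ℂ h rightHalfPlane ∧ (∀ z ∉ rightHalfPlane, h z = 0) ∧
    MemLp h 2 (bergmanMeasure ℓ)}
  zero_mem' := ⟨differentiableOn_const 0, fun _ _ => rfl, MemLp.zero⟩
  add_mem' := fun {h k} hh hk => ⟨hh.1.add hk.1,
    fun z hz => by simp [hh.2.1 z hz, hk.2.1 z hz], hh.2.2.add hk.2.2⟩
  smul_mem' := fun c h hh => ⟨hh.1.const_smul c,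
    fun z hz => by simp [hh.2.1 z hz], hh.2.2.const_smul c⟩

/-- The weighted Bergman space `A²_ℓ` of the right half-plane. (A type of its own, so that it
carries the norm topology and not the topology of pointwise convergence.) -/
def BergmanSpace (ℓ : ℕ) : Type := bergmanSubmodule ℓ

namespace BergmanSpace

variable {ℓ : ℕ}

instance : AddCommGroup (BergmanSpace ℓ) := inferInstanceAs (AddCommGroup (bergmanSubmodule ℓ))

instance : Module ℂ (BergmanSpace ℓ) := inferInstanceAs (Module ℂ (bergmanSubmodule ℓ))

instance : CoeFun (BergmanSpace ℓ) (fun _ => ℂ → ℂ) := ⟨fun h => h.1⟩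

theorem ext {h k : BergmanSpace ℓ} (H : ∀ z, h z = k z) : h = k := Subtype.ext (funext H)

theorem memLp (h : BergmanSpace ℓ) : MemLp h 2 (bergmanMeasure ℓ) := h.2.2.2

theorem isOpen_rightHalfPlane : IsOpen rightHalfPlane :=
  isOpen_lt continuous_const Complex.continuous_re

theorem measurable_density :
    Measurable fun z : ℂ => ENNReal.ofReal (z.re ^ ℓ / Real.pi) := by fun_prop

theorem ae_bergman {p : ℂ → Prop} (h : ∀ᵐ z ∂(bergmanMeasure ℓ), p z) :
    ∀ᵐ z ∂(volume.restrict rightHalfPlane), p z := by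
  rw [bergmanMeasure, ae_withDensity_iff measurable_density] at h
  filter_upwards [h, ae_restrict_mem isOpen_rightHalfPlane.measurableSet] with z hz hz'
  have : 0 < z.re := hz'
  exact hz (by simp only [ne_eq, ENNReal.ofReal_eq_zero, not_le]; positivity)

theorem eqOn_of_ae {h k : ℂ → ℂ} (hh : DifferentiableOn ℂ h rightHalfPlane)
    (hk : DifferentiableOn ℂ k rightHalfPlane) (H : h =ᵐ[bergmanMeasure ℓ] k) :
    EqOn h k rightHalfPlane :=
  Measure.eqOn_open_of_ae_eq (ae_bergman H) isOpen_rightHalfPlane hh.continuousOn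
    hk.continuousOn

/-- The class of an element of `A²_ℓ` in `L²`. -/
def toLp : BergmanSpace ℓ →ₗ[ℂ] Lp ℂ 2 (bergmanMeasure ℓ) where
  toFun h := (memLp h).toLp h
  map_add' _ _ := rfl
  map_smul' _ _ := rfl

theorem coeFn_toLp (h : BergmanSpace ℓ) : (toLp h : ℂ → ℂ) =ᵐ[bergmanMeasure ℓ] h :=
  (memLp h).coeFn_toLp

theorem toLp_injective : Function.Injective (toLp (ℓ := ℓ)) := by
  intro h k H
  have H' : (h : ℂ → ℂ) =ᵐ[bergmanMeasure ℓ] k :=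
    (coeFn_toLp h).symm.trans (H ▸ coeFn_toLp k)
  refine ext fun z => ?_
  by_cases hz : z ∈ rightHalfPlane
  · exact eqOn_of_ae h.2.1 k.2.1 H' hz
  · rw [h.2.2.1 z hz, k.2.2.1 z hz]

instance : NormedAddCommGroup (BergmanSpace ℓ) :=
  NormedAddCommGroup.induced _ _ toLp toLp_injective

/-- The inner product `⟪h, k⟫ = (1/π) ∫∫ x ^ ℓ conj (h (x + i y)) k (x + i y) dx dy`, linear in
the second variable as everywhere in Mathlib. -/
instance : InnerProductSpace ℂ (BergmanSpace ℓ) where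
  inner h k := ∫ z, conj (h z) * k z ∂(bergmanMeasure ℓ)
  norm_smul_le c h := by
    change ‖toLp (c • h)‖ ≤ ‖c‖ * ‖toLp h‖
    rw [map_smul, norm_smul]
  norm_sq_eq_re_inner h := by
    change ‖toLp h‖ ^ 2 = _
    rw [norm_sq_eq_re_inner (𝕜 := ℂ), L2.inner_def]
    congr 1
    refine integral_congr_ae ?_
    filter_upwards [coeFn_toLp h] with z hz
    rw [hz, RCLike.inner_apply']
  conj_inner_symm h k := by
    rw [← integral_conj]
    congr 1
    ext z
    simp [mul_comm]
  add_left h k l := by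
    rw [← integral_add]
    · congr 1
      ext z
      change conj (h z + k z) * l z = _
      simp [add_mul]
    · exact (memLp h).star.integrable_mul (memLp l)
    · exact (memLp k).star.integrable_mul (memLp l)
  smul_left h k c := by
    rw [← integral_const_mul]
    congr 1
    ext z
    change conj (c * h z) * k z = _
    simp [mul_assoc]

theorem norm_sq_eq (h : BergmanSpace ℓ) :
    ‖h‖ ^ 2 = 1 / Real.pi * ∫ z in rightHalfPlane, z.re ^ ℓ * ‖h z‖ ^ 2 := by
  rw [norm_sq_eq_re_inner (𝕜 := ℂ)]
  change RCLike.re (∫ z, conj (h z) * h z ∂(bergmanMeasure ℓ)) = _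
  have h1 : ∀ z, conj (h z) * h z = ((‖h z‖ ^ 2 : ℝ) : ℂ) := fun z => by
    rw [Complex.conj_mul']; push_cast; rfl
  simp_rw [h1]
  rw [integral_complex_ofReal, bergmanMeasure,
    integral_withDensity_eq_integral_toReal_smul measurable_density
      (Eventually.of_forall fun _ => ENNReal.ofReal_lt_top), ← integral_const_mul]
  change (∫ z in rightHalfPlane, _) = _
  refine setIntegral_congr_fun isOpen_rightHalfPlane.measurableSet fun z hz => ?_
  have hz' : 0 < z.re := hz
  simp only [smul_eq_mul]
  rw [ENNReal.toReal_ofReal (by positivity)]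
  ring

/-- The mean value inequality on a disc, with a constant that depends only on the radius. -/
theorem enorm_le_lintegral_ball {h : ℂ → ℂ} {c : ℂ} {r : ℝ} (hr : 0 < r)
    (hh : DifferentiableOn ℂ h (Metric.ball c r)) :
    ENNReal.ofReal (r / 2) * ENNReal.ofReal (r / 2) * ‖h c‖ₑ ≤
      ∫⁻ z in Metric.ball c r, ‖h z‖ₑ := by
  have key : ∀ ρ ∈ Ioo (r / 2) r,
      ‖h c‖ₑ ≤ ∫⁻ θ in Ioo (-Real.pi) Real.pi, ‖h (c + Complex.polarCoord.symm (ρ, θ))‖ₑ := by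
    intro ρ hρ
    have hρ0 : 0 < ρ := by linarith [hρ.1]
    have hsub : Metric.closedBall c ρ ⊆ Metric.ball c r := Metric.closedBall_subset_ball hρ.2
    have hd : DiffContOnCl ℂ h (Metric.ball c |ρ|) := by
      rw [abs_of_pos hρ0]
      exact (hh.mono hsub).diffContOnCl_ball subset_rfl
    have hm := hd.circleAverage
    rw [Real.circleAverage_eq_integral_add (-Real.pi),
      intervalIntegral.integral_comp_add_right (fun θ => h (circleMap c ρ θ)),
      intervalIntegral.integral_of_le (by linarith [Real.pi_pos])] at hm
    rw [← hm, zero_add, show 2 * Real.pi + -Real.pi = Real.pi by ring, enorm_smul,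
      ← setLIntegral_congr Ioo_ae_eq_Ioc.symm]
    have hpi : ‖(2 * Real.pi)⁻¹‖ₑ ≤ 1 := by
      rw [← ofReal_norm, ENNReal.ofReal_le_one, norm_inv, Real.norm_of_nonneg (by positivity)]
      exact inv_le_one_of_one_le₀ (by linarith [Real.pi_gt_three])
    calc _ ≤ 1 * ∫⁻ θ in Ioc (-Real.pi) Real.pi, ‖h (circleMap c ρ θ)‖ₑ := by
          gcongr
          exact enorm_integral_le_lintegral_enorm _
      _ = _ := by
          rw [one_mul]
          refine lintegral_congr fun θ => ?_
          simp [circleMap, Complex.exp_mul_I]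
  have h1 : ∫⁻ z in Metric.ball c r, ‖h z‖ₑ =
      ∫⁻ z, (Metric.ball c r).indicator (fun z => ‖h z‖ₑ) (c + z) := by
    rw [lintegral_add_left_eq_self (fun z => (Metric.ball c r).indicator (fun z => ‖h z‖ₑ) z) c,
      lintegral_indicator measurableSet_ball]
  rw [h1, ← Complex.lintegral_comp_polarCoord_symm, polarCoord_target]
  have h2 : ∀ ρ ∈ Ioo (r / 2) r, ∀ θ ∈ Ioo (-Real.pi) Real.pi,
      ENNReal.ofReal (r / 2) * ‖h (c + Complex.polarCoord.symm (ρ, θ))‖ₑ ≤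
      ENNReal.ofReal ρ • (Metric.ball c r).indicator (fun z => ‖h z‖ₑ)
        (c + Complex.polarCoord.symm (ρ, θ)) := by
    intro ρ hρ θ _
    have hρ0 : 0 < ρ := by linarith [hρ.1]
    rw [indicator_of_mem, smul_eq_mul]
    · gcongr
      exact hρ.1.le
    · rw [mem_ball_iff_norm, add_sub_cancel_left, Complex.norm_polarCoord_symm]
      simpa [abs_of_pos hρ0] using hρ.2
  have hmeas : Measurable fun p : ℝ × ℝ =>
      ENNReal.ofReal p.1 • (Metric.ball c r).indicator (fun z => ‖h z‖ₑ)
        (c + Complex.polarCoord.symm p) := by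
    have h3 : Measurable ((Metric.ball c r).indicator fun z => ‖h z‖ₑ) := by
      classical
      rw [← piecewise_eq_indicator]
      exact ContinuousOn.measurable_piecewise hh.continuousOn.enorm continuousOn_const
        measurableSet_ball
    have h4 : Measurable fun p : ℝ × ℝ => c + Complex.polarCoord.symm p := by
      simp only [Complex.polarCoord_symm_apply]
      fun_prop
    exact (ENNReal.measurable_ofReal.comp measurable_fst).mul (h3.comp h4)
  rw [Measure.volume_eq_prod, ← Measure.prod_restrict, lintegral_prod _ hmeas.aemeasurable]
  have hsub : Ioo (r / 2) r ⊆ Ioi 0 := fun ρ hρ => by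
    have := hρ.1
    change 0 < ρ
    linarith
  calc _ = ∫⁻ _ in Ioo (r / 2) r, ENNReal.ofReal (r / 2) * ‖h c‖ₑ := by
        rw [setLIntegral_const, Real.volume_Ioo, show r - r / 2 = r / 2 by ring]
        ring
    _ ≤ ∫⁻ ρ in Ioo (r / 2) r, ∫⁻ θ in Ioo (-Real.pi) Real.pi,
          ENNReal.ofReal ρ • (Metric.ball c r).indicator (fun z => ‖h z‖ₑ)
            (c + Complex.polarCoord.symm (ρ, θ)) := by
        refine setLIntegral_mono' measurableSet_Ioo fun ρ hρ => ?_
        refine le_trans (mul_le_mul_right (key ρ hρ) _) ?_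
        rw [← lintegral_const_mul' _ _ ENNReal.ofReal_ne_top]
        exact setLIntegral_mono' measurableSet_Ioo fun θ hθ => h2 ρ hρ θ hθ
    _ ≤ _ := lintegral_mono_set hsub

theorem exists_bound {c : ℂ} (hc : c ∈ rightHalfPlane) : ∃ C : ℝ, ∃ r > 0,
    Metric.ball c r ⊆ rightHalfPlane ∧
      ∀ h : BergmanSpace ℓ, ∀ z ∈ Metric.ball c r, ‖h z‖ ≤ C * ‖h‖ := by
  have hc0 : 0 < c.re := hc
  set r : ℝ := c.re / 4 with hr
  have hr0 : 0 < r := by positivity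
  set m : ℝ := (c.re / 2) ^ ℓ / Real.pi with hm
  have hm0 : 0 < m := by positivity
  have hre : ∀ w, dist w c < 2 * r → c.re / 2 < w.re := by
    intro w hw
    have h1 : |w.re - c.re| ≤ dist w c := by
      rw [dist_eq_norm, ← Complex.sub_re]
      exact Complex.abs_re_le_norm _
    have h2 := (abs_le.mp h1).1
    rw [hr] at hw
    linarith
  refine ⟨√((m * (r / 2) ^ 2)⁻¹), r, hr0, fun w hw => ?_, fun h z hz => ?_⟩
  · have h1 := hre w (by rw [Metric.mem_ball] at hw; linarith)
    change 0 < w.re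
    linarith
  have hball : ∀ w ∈ Metric.ball z r, c.re / 2 < w.re := fun w hw => hre w (by
    rw [Metric.mem_ball] at hw hz
    linarith [dist_triangle w z c])
  have hsub : Metric.ball z r ⊆ rightHalfPlane := fun w hw => by
    have := hball w hw
    change 0 < w.re
    linarith
  have h1 := enorm_le_lintegral_ball (h := fun w => h w ^ 2) (c := z) hr0
    ((h.2.1.pow 2).mono hsub)
  have h2 : ENNReal.ofReal m * ∫⁻ w in Metric.ball z r, ‖h w ^ 2‖ₑ ≤ ‖h‖ₑ ^ 2 := by
    have h3 : ‖h‖ₑ ^ 2 = ∫⁻ w, ‖h w‖ₑ ^ 2 ∂(bergmanMeasure ℓ) := by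
      have h4 : ‖h‖ₑ = eLpNorm h 2 (bergmanMeasure ℓ) := Lp.enorm_toLp (memLp h)
      have h5 := eLpNorm_nnreal_pow_eq_lintegral (f := h) (μ := bergmanMeasure ℓ)
        (p := 2) (by norm_num)
      simpa [h4] using h5
    rw [h3, ← lintegral_const_mul' _ _ ENNReal.ofReal_ne_top, bergmanMeasure,
      lintegral_withDensity_eq_lintegral_mul_non_measurable _ measurable_density
        (Eventually.of_forall fun _ => ENNReal.ofReal_lt_top)]
    refine le_trans (setLIntegral_mono' measurableSet_ball fun w hw => ?_)
      (lintegral_mono_set hsub)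
    rw [enorm_pow, Pi.mul_apply]
    gcongr
    have := (hball w hw).le
    rw [hm]
    gcongr
  have h3 : ENNReal.ofReal (m * (r / 2) ^ 2 * ‖h z‖ ^ 2) ≤ ENNReal.ofReal (‖h‖ ^ 2) := by
    rw [ENNReal.ofReal_pow (norm_nonneg _), ofReal_norm]
    refine le_trans (le_of_eq ?_) ((mul_le_mul_right h1 (ENNReal.ofReal m)).trans h2)
    rw [ENNReal.ofReal_mul (by positivity), ENNReal.ofReal_mul hm0.le, enorm_pow,
      ENNReal.ofReal_pow (by positivity), ENNReal.ofReal_pow (by positivity),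
      ofReal_norm]
    ring
  rw [ENNReal.ofReal_le_ofReal_iff (by positivity)] at h3
  have hk : 0 < m * (r / 2) ^ 2 := by positivity
  rw [← Real.sqrt_sq (norm_nonneg h), ← Real.sqrt_mul (by positivity)]
  refine Real.le_sqrt_of_sq_le ?_
  rw [inv_mul_eq_div, le_div_iff₀ hk]
  linarith

instance : CompleteSpace (BergmanSpace ℓ) := by
  refine Metric.complete_of_cauchySeq_tendsto fun u hu => ?_
  have hcauchy : ∀ c ∈ rightHalfPlane, ∃ r > 0,
      UniformCauchySeqOn (fun n => (u n : ℂ → ℂ)) atTop (Metric.ball c r) := by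
    intro c hc
    obtain ⟨C, r, hr, _, hC⟩ := exists_bound (ℓ := ℓ) hc
    refine ⟨r, hr, Metric.uniformCauchySeqOn_iff.mpr fun ε hε => ?_⟩
    obtain ⟨N, hN⟩ := Metric.cauchySeq_iff.mp hu (ε / (|C| + 1)) (by positivity)
    refine ⟨N, fun m hm n hn z hz => ?_⟩
    have h1 := hN m hm n hn
    rw [dist_eq_norm, lt_div_iff₀ (by positivity)] at h1
    have h2 : ‖u m z - u n z‖ ≤ C * ‖u m - u n‖ := hC (u m - u n) z hz
    rw [dist_eq_norm]
    nlinarith [le_abs_self C, norm_nonneg (u m - u n)]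
  have hpt : ∀ z, ∃ l, Tendsto (fun n => u n z) atTop (𝓝 l) := by
    intro z
    by_cases hz : z ∈ rightHalfPlane
    · obtain ⟨r, hr, h⟩ := hcauchy z hz
      exact cauchySeq_tendsto_of_complete (h.cauchySeq (Metric.mem_ball_self hr))
    · exact ⟨0, by simp [fun n => (u n).2.2.1 z hz]⟩
  choose F hF using hpt
  have hloc : TendstoLocallyUniformlyOn (fun n => (u n : ℂ → ℂ)) F atTop rightHalfPlane := by
    intro s hs c hc
    obtain ⟨r, hr, h⟩ := hcauchy c hc
    exact ⟨Metric.ball c r, mem_nhdsWithin_of_mem_nhds (Metric.ball_mem_nhds c hr),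
      h.tendstoUniformlyOn_of_tendsto (fun z _ => hF z) s hs⟩
  have hFd : DifferentiableOn ℂ F rightHalfPlane :=
    hloc.differentiableOn (Eventually.of_forall fun n => (u n).2.1) isOpen_rightHalfPlane
  have hF0 : ∀ z ∉ rightHalfPlane, F z = 0 := fun z hz =>
    tendsto_nhds_unique (hF z) (by simp [fun n => (u n).2.2.1 z hz])
  have hcau : CauchySeq fun n => toLp (u n) := by
    rw [Metric.cauchySeq_iff] at hu ⊢
    exact hu
  obtain ⟨G, hG⟩ := cauchySeq_tendsto_of_complete hcau
  obtain ⟨ns, hns, hae⟩ := (tendstoInMeasure_of_tendsto_Lp hG).exists_seq_tendsto_ae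
  have hFG : (G : ℂ → ℂ) =ᵐ[bergmanMeasure ℓ] F := by
    filter_upwards [hae, ae_all_iff.mpr fun n => coeFn_toLp (u n)] with z h1 h2
    simp only [h2] at h1
    exact tendsto_nhds_unique h1 ((hF z).comp hns.tendsto_atTop)
  let x : BergmanSpace ℓ := ⟨F, hFd, hF0, (memLp_congr_ae hFG).mp (Lp.memLp G)⟩
  have hx : toLp x = G := Lp.ext ((coeFn_toLp x).trans hFG.symm)
  refine ⟨x, ?_⟩
  rw [← hx, tendsto_iff_dist_tendsto_zero] at hG
  rw [tendsto_iff_dist_tendsto_zero]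
  exact hG

end BergmanSpace

/-- The weighted composition expression `f · (h ∘ g)` on the right half-plane (extended by zero). -/
def weightedComp (f g h : ℂ → ℂ) : ℂ → ℂ :=
  rightHalfPlane.indicator fun z => f z * h (g z)

theorem weightedComp_add (f g h k : ℂ → ℂ) :
    weightedComp f g (h + k) = weightedComp f g h + weightedComp f g k := by
  ext z
  by_cases hz : z ∈ rightHalfPlane <;> simp [weightedComp, hz, mul_add]

theorem weightedComp_smul (f g : ℂ → ℂ) (c : ℂ) (h : ℂ → ℂ) :
    weightedComp f g (c • h) = c • weightedComp f g h := by
  ext z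
  by_cases hz : z ∈ rightHalfPlane <;> simp [weightedComp, hz, mul_left_comm]

/-- The maximal weighted composition operator on `A²_ℓ`: its domain consists of all `h` in `A²_ℓ`
for which `f · (h ∘ g)` is in `A²_ℓ`, and there it sends `h` to `f · (h ∘ g)`. -/
def maxWeightedComp (ℓ : ℕ) (f g : ℂ → ℂ) : BergmanSpace ℓ →ₗ.[ℂ] BergmanSpace ℓ where
  domain :=
    { carrier := {h | weightedComp f g h ∈ bergmanSubmodule ℓ}
      zero_mem' := by
        change weightedComp f g 0 ∈ bergmanSubmodule ℓ
        rw [show weightedComp f g 0 = 0 by ext z; simp [weightedComp]]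
        exact zero_mem _
      add_mem' := fun {h k} hh hk => by
        change weightedComp f g ((h : ℂ → ℂ) + k) ∈ bergmanSubmodule ℓ
        rw [weightedComp_add]
        exact add_mem hh hk
      smul_mem' := fun c h hh => by
        change weightedComp f g (c • (h : ℂ → ℂ)) ∈ bergmanSubmodule ℓ
        rw [weightedComp_smul]
        exact (bergmanSubmodule ℓ).smul_mem c hh }
  toFun :=
    { toFun := fun h => ⟨weightedComp f g h.1, h.2⟩
      map_add' := fun h k => Subtype.ext (weightedComp_add f g h.1 k.1)
      map_smul' := fun c h => Subtype.ext (weightedComp_smul f g c h.1) }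

/-- A partially defined operator is bounded if it is defined everywhere and
`‖T h‖ ≤ L ‖h‖` for a constant `L > 0`. -/
def IsBoundedOperator {E : Type*} [NormedAddCommGroup E] [InnerProductSpace ℂ E]
    (T : E →ₗ.[ℂ] E) : Prop :=
  T.domain = ⊤ ∧ ∃ L : ℝ, 0 < L ∧ ∀ h : T.domain, ‖T h‖ ≤ L * ‖(h : E)‖

end

/-! Put n = ℓ + 2. Up to a positive constant, k_w(z) = 1/(z + conj w)^n is the reproducing kernel of
the space (`inner_bergmanKernel`). Since (f · (h ∘ g))(w) = f(w) h(g(w)), the adjoint sends k_w to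
conj (f w) · k_{g w}. A hermitian operator must do the same to k_w, and this is the functional
equation f(z) (z + conj g(w))^n = conj f(w) (g(z) + conj w)^n of `KernelSymmetric`.

The logarithmic derivative in z removes conj f(w) and the exponent. At z = 1 it reads k + 1/(1 +
conj g(w)) = a/(b + conj w) with constants k, a, b, unless f vanishes identically. Hence g is
constant (a = 0), affine (k = 0) or a Möbius map with a finite pole. Comparing coefficients makes
the parameters real or ties them to each other; the inequalities between them say that g preserves
the half-plane (`KernelSymmetric.classification`).

Conversely, each family solves the functional equation and gives a bounded operator: rank one if g
is constant, and otherwise by a change of variables along the injective map g. A bounded operator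
that agrees with its adjoint on the kernels is self-adjoint, because kernels detect point values
(`KernelSymmetric.isSelfAdjoint`). Boundedness of every hermitian operator is thus read off the list
of symbols. -/

/-! ### Holomorphic change of variables and radial mean values -/

theorem hasFDerivAt_real_of_hasDerivAt {φ : ℂ → ℂ} {φ' z : ℂ} (h : HasDerivAt φ φ' z) :
    HasFDerivAt φ ((ContinuousLinearMap.toSpanSingleton ℂ φ').restrictScalars ℝ) z :=
  h.hasFDerivAt.restrictScalars ℝ

theorem abs_det_toSpanSingleton (a : ℂ) :
    |((ContinuousLinearMap.toSpanSingleton ℂ a).restrictScalars ℝ).det| = ‖a‖ ^ 2 := by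
  simp [ContinuousLinearMap.det, LinearMap.det_restrictScalars, Algebra.norm_complex_eq,
    Complex.normSq_eq_norm_sq]

/-- Change of variables in a Lebesgue integral along an injective holomorphic map. -/
theorem lintegral_image_holomorphic {φ φ' : ℂ → ℂ} {s : Set ℂ} (hs : MeasurableSet s)
    (hφ : ∀ z ∈ s, HasDerivAt φ (φ' z) z) (hinj : InjOn φ s) (G : ℂ → ℝ≥0∞) :
    ∫⁻ z in φ '' s, G z = ∫⁻ z in s, ENNReal.ofReal (‖φ' z‖ ^ 2) * G (φ z) := by
  rw [lintegral_image_eq_lintegral_abs_det_fderiv_mul volume hs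
    (fun z hz => (hasFDerivAt_real_of_hasDerivAt (hφ z hz)).hasFDerivWithinAt) hinj]
  simp_rw [abs_det_toSpanSingleton]

theorem integral_image_holomorphic {φ φ' : ℂ → ℂ} {s : Set ℂ} (hs : MeasurableSet s)
    (hφ : ∀ z ∈ s, HasDerivAt φ (φ' z) z) (hinj : InjOn φ s) (G : ℂ → ℂ) :
    ∫ z in φ '' s, G z = ∫ z in s, ‖φ' z‖ ^ 2 • G (φ z) := by
  rw [integral_image_eq_integral_abs_det_fderiv_smul volume hs
    (fun z hz => (hasFDerivAt_real_of_hasDerivAt (hφ z hz)).hasFDerivWithinAt) hinj]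
  simp_rw [abs_det_toSpanSingleton]

theorem integrableOn_image_holomorphic {φ φ' : ℂ → ℂ} {s : Set ℂ} (hs : MeasurableSet s)
    (hφ : ∀ z ∈ s, HasDerivAt φ (φ' z) z) (hinj : InjOn φ s) {G : ℂ → ℂ}
    (hG : IntegrableOn G (φ '' s)) : IntegrableOn (fun z => ‖φ' z‖ ^ 2 • G (φ z)) s := by
  rw [integrableOn_image_iff_integrableOn_abs_det_fderiv_smul volume hs
    (fun z hz => (hasFDerivAt_real_of_hasDerivAt (hφ z hz)).hasFDerivWithinAt) hinj] at hG
  simpa only [abs_det_toSpanSingleton] using hG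

/-- The mean value property on a circle, with the angle in (-π, π) to match the target of
`Complex.polarCoord`. -/
theorem integral_circle_eq {F : ℂ → ℂ} {R ρ : ℝ} (hF : DifferentiableOn ℂ F (Metric.ball 0 R))
    (hρ : ρ ∈ Ioo 0 R) :
    ∫ θ in Ioo (-Real.pi) Real.pi, F (Complex.polarCoord.symm (ρ, θ)) =
      (2 * Real.pi : ℝ) • F 0 := by
  have hsub : Metric.closedBall (0 : ℂ) ρ ⊆ Metric.ball 0 R := Metric.closedBall_subset_ball hρ.2
  have hd : DiffContOnCl ℂ F (Metric.ball 0 |ρ|) := by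
    rw [abs_of_pos hρ.1]
    exact (hF.mono hsub).diffContOnCl_ball subset_rfl
  have hm := hd.circleAverage
  rw [Real.circleAverage_eq_integral_add (-Real.pi),
    intervalIntegral.integral_comp_add_right (fun θ => F (circleMap 0 ρ θ)),
    intervalIntegral.integral_of_le (by linarith [Real.pi_pos]), zero_add,
    show 2 * Real.pi + -Real.pi = Real.pi by ring, ← setIntegral_congr_set Ioo_ae_eq_Ioc,
    inv_smul_eq_iff₀ (by positivity)] at hm
  rw [← hm]
  congr 1
  ext θ
  simp [circleMap, Complex.exp_mul_I]

/-- The mean value property of holomorphic functions on a disc for a radial weight. -/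
theorem integral_ball_radial_smul {F : ℂ → ℂ} {R : ℝ} (w : ℝ → ℝ) (hw : Measurable w)
    (hF : DifferentiableOn ℂ F (Metric.ball 0 R))
    (hint : IntegrableOn (fun u => w ‖u‖ • F u) (Metric.ball 0 R)) :
    ∫ u in Metric.ball 0 R, w ‖u‖ • F u =
      (∫ ρ in Ioo 0 R, ρ * w ρ * (2 * Real.pi)) • F 0 := by
  -- Extension by zero gives a globally measurable function, to which the polar coordinate formula
  -- on the whole plane applies.
  set G : ℂ → ℂ := (Metric.ball 0 R).indicator fun u => w ‖u‖ • F u with hG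
  have hGm : Measurable G := by
    have h1 : Measurable ((Metric.ball 0 R).indicator F) := by
      classical
      rw [← piecewise_eq_indicator]
      exact ContinuousOn.measurable_piecewise hF.continuousOn continuousOn_const
        measurableSet_ball
    have h2 : G = fun u => w ‖u‖ • (Metric.ball 0 R).indicator F u := by
      ext u
      by_cases hu : u ∈ Metric.ball (0 : ℂ) R <;> simp only [hG, indicator, hu, if_true, if_false,
        smul_zero]
    rw [h2]
    exact (hw.comp measurable_norm).smul h1
  have hGi : Integrable G := hint.integrable_indicator measurableSet_ball
  have hsymm : Measurable fun p : ℝ × ℝ => Complex.polarCoord.symm p := by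
    simp only [Complex.polarCoord_symm_apply]
    fun_prop
  have hpi : IntegrableOn (fun p : ℝ × ℝ => p.1 • G (Complex.polarCoord.symm p))
      (Ioi 0 ×ˢ Ioo (-Real.pi) Real.pi) := by
    refine ⟨(measurable_fst.smul (hGm.comp hsymm)).aestronglyMeasurable, ?_⟩
    have h1 := hGi.2
    rw [HasFiniteIntegral, ← Complex.lintegral_comp_polarCoord_symm, polarCoord_target] at h1
    refine lt_of_le_of_lt (le_of_eq ?_) h1
    refine setLIntegral_congr_fun (measurableSet_Ioi.prod measurableSet_Ioo) fun p hp => ?_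
    have hp1 : 0 < p.1 := hp.1
    simp only [enorm_smul, smul_eq_mul]
    rw [Real.enorm_of_nonneg hp1.le]
  rw [← integral_indicator measurableSet_ball, ← hG, ← Complex.integral_comp_polarCoord_symm,
    polarCoord_target, Measure.volume_eq_prod, setIntegral_prod _ hpi]
  have hin : ∀ ρ ∈ Ioi (0 : ℝ), ∫ θ in Ioo (-Real.pi) Real.pi,
      ρ • G (Complex.polarCoord.symm (ρ, θ)) =
      (Ioo 0 R).indicator (fun ρ => (ρ * w ρ * (2 * Real.pi)) • F 0) ρ := by
    intro ρ hρ
    have hρ0 : 0 < ρ := hρ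
    have hn : ∀ θ, ‖Complex.polarCoord.symm (ρ, θ)‖ = ρ := fun θ => by
      rw [Complex.norm_polarCoord_symm, abs_of_pos hρ0]
    by_cases hR : ρ < R
    · rw [indicator_of_mem (show ρ ∈ Ioo 0 R from ⟨hρ0, hR⟩), mul_smul, ← integral_circle_eq hF ⟨hρ0, hR⟩, mul_smul,
        ← integral_smul, ← integral_smul]
      refine integral_congr_ae (Eventually.of_forall fun θ => ?_)
      simp only [hG]
      rw [indicator_of_mem (by rw [mem_ball_zero_iff, hn]; exact hR), hn]
    · rw [indicator_of_notMem (fun h => hR h.2)]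
      refine integral_eq_zero_of_ae (Eventually.of_forall fun θ => ?_)
      simp only [hG]
      rw [indicator_of_notMem (by rw [mem_ball_zero_iff, hn]; exact hR), smul_zero, Pi.zero_apply]
  rw [setIntegral_congr_fun measurableSet_Ioi hin, setIntegral_indicator measurableSet_Ioo,
    inter_eq_right.mpr (Ioo_subset_Ioi_self : Ioo 0 R ⊆ Ioi 0), integral_smul_const]

/-! ### The half-plane and its Cayley maps -/

theorem add_conj_mem_rightHalfPlane {z w : ℂ} (hz : z ∈ rightHalfPlane)
    (hw : w ∈ rightHalfPlane) : z + conj w ∈ rightHalfPlane := by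
  have h1 : 0 < z.re := hz
  have h2 : 0 < w.re := hw
  change 0 < (z + conj w).re
  simp only [Complex.add_re, Complex.conj_re]
  linarith

theorem ne_zero_of_mem_rightHalfPlane {z : ℂ} (hz : z ∈ rightHalfPlane) : z ≠ 0 := by
  rintro rfl
  exact lt_irrefl _ (show (0 : ℝ) < (0 : ℂ).re from hz)

theorem one_sub_ne_zero_of_mem_ball {u : ℂ} (hu : u ∈ Metric.ball (0 : ℂ) 1) : 1 - u ≠ 0 := by
  rw [mem_ball_zero_iff] at hu
  intro h
  rw [← sub_eq_zero.mp h] at hu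
  simp at hu

/-- The conformal map of the unit disc onto the right half-plane that sends `0` to `w`. -/
noncomputable def cayley (w u : ℂ) : ℂ := (w + conj w * u) / (1 - u)

/-- In the disc coordinate the kernel at w becomes a constant times (1 - u)^(ℓ + 2). -/
theorem cayley_add_conj (w : ℂ) {u : ℂ} (hu : u ∈ Metric.ball (0 : ℂ) 1) :
    cayley w u + conj w = ((2 * w.re : ℝ) : ℂ) / (1 - u) := by
  have := one_sub_ne_zero_of_mem_ball hu
  rw [← Complex.add_conj, cayley]
  field_simp
  ring

/-- The weight splits into a radial factor and a power of |1 - u|; the latter will cancel against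
the Jacobian and the kernel. -/
theorem cayley_re (w : ℂ) {u : ℂ} (hu : u ∈ Metric.ball (0 : ℂ) 1) :
    (cayley w u).re = w.re * (1 - ‖u‖ ^ 2) / ‖1 - u‖ ^ 2 := by
  have h0 := one_sub_ne_zero_of_mem_ball hu
  have h1 : Complex.normSq (1 - u) ≠ 0 := by simpa using h0
  rw [cayley, Complex.div_re, ← Complex.normSq_eq_norm_sq, ← Complex.normSq_eq_norm_sq]
  field_simp
  simp [Complex.normSq_apply]
  ring

theorem hasDerivAt_cayley (w : ℂ) {u : ℂ} (hu : u ∈ Metric.ball (0 : ℂ) 1) :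
    HasDerivAt (cayley w) (((2 * w.re : ℝ) : ℂ) / (1 - u) ^ 2) u := by
  have h0 := one_sub_ne_zero_of_mem_ball hu
  have h1 : HasDerivAt (fun u : ℂ => w + conj w * u) (conj w) u := by
    simpa using ((hasDerivAt_id u).const_mul (conj w)).const_add w
  have h2 : HasDerivAt (fun u : ℂ => 1 - u) (-1) u := by
    simpa using (hasDerivAt_id u).const_sub 1
  convert! h1.div h2 h0 using 1
  rw [← Complex.add_conj]
  ring

theorem cayley_mem {w : ℂ} (hw : w ∈ rightHalfPlane) {u : ℂ} (hu : u ∈ Metric.ball (0 : ℂ) 1) :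
    cayley w u ∈ rightHalfPlane := by
  change 0 < (cayley w u).re
  have hw' : 0 < w.re := hw
  rw [cayley_re w hu]
  have h0 : 0 < ‖1 - u‖ := norm_pos_iff.mpr (one_sub_ne_zero_of_mem_ball hu)
  rw [mem_ball_zero_iff] at hu
  have : 0 < 1 - ‖u‖ ^ 2 := by nlinarith [norm_nonneg u]
  positivity

theorem injOn_cayley {w : ℂ} (hw : w ∈ rightHalfPlane) :
    InjOn (cayley w) (Metric.ball (0 : ℂ) 1) := by
  intro u hu v hv h
  have hw' : 0 < w.re := hw
  have h1 := cayley_add_conj w hu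
  rw [h, cayley_add_conj w hv] at h1
  have h2 := one_sub_ne_zero_of_mem_ball hu
  have h3 := one_sub_ne_zero_of_mem_ball hv
  have h4 : ((2 * w.re : ℝ) : ℂ) ≠ 0 := by
    rw [Complex.ofReal_ne_zero]; positivity
  rw [div_eq_div_iff h3 h2] at h1
  have := mul_left_cancel₀ h4 h1
  linear_combination -this

theorem cayley_image {w : ℂ} (hw : w ∈ rightHalfPlane) :
    cayley w '' Metric.ball (0 : ℂ) 1 = rightHalfPlane := by
  refine Subset.antisymm (image_subset_iff.mpr fun u hu => cayley_mem hw hu) fun z hz => ?_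
  have h0 : z + conj w ≠ 0 := ne_zero_of_mem_rightHalfPlane (add_conj_mem_rightHalfPlane hz hw)
  have h1 : w + conj w ≠ 0 := ne_zero_of_mem_rightHalfPlane (add_conj_mem_rightHalfPlane hw hw)
  have hz' : 0 < z.re := hz
  have hw' : 0 < w.re := hw
  refine ⟨(z - w) / (z + conj w), ?_, ?_⟩
  · rw [mem_ball_zero_iff, norm_div, div_lt_one (norm_pos_iff.mpr h0)]
    refine lt_of_pow_lt_pow_left₀ 2 (norm_nonneg _) ?_
    -- |z + conj w|² - |z - w|² = 4 Re z Re w.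
    rw [← Complex.normSq_eq_norm_sq, ← Complex.normSq_eq_norm_sq, Complex.normSq_apply,
      Complex.normSq_apply]
    simp only [Complex.sub_re, Complex.sub_im, Complex.add_re, Complex.add_im, Complex.conj_re,
      Complex.conj_im]
    nlinarith [mul_pos hz' hw']
  · have h2 : 1 - (z - w) / (z + conj w) = (w + conj w) / (z + conj w) := by
      field_simp
      ring
    rw [cayley, h2]
    field_simp
    ring

/-! ### Reproducing kernels -/

/-- The function `z ↦ 1 / (z + conj w) ^ (ℓ + 2)` on the right half-plane. -/
noncomputable def kernelFun (ℓ : ℕ) (w : ℂ) : ℂ → ℂ :=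
  rightHalfPlane.indicator fun z => 1 / (z + conj w) ^ (ℓ + 2)

theorem kernelFun_apply {ℓ : ℕ} {w z : ℂ} (hz : z ∈ rightHalfPlane) :
    kernelFun ℓ w z = 1 / (z + conj w) ^ (ℓ + 2) := indicator_of_mem hz _

theorem differentiableOn_kernelFun (ℓ : ℕ) {w : ℂ} (hw : w ∈ rightHalfPlane) :
    DifferentiableOn ℂ (kernelFun ℓ w) rightHalfPlane := by
  refine DifferentiableOn.congr (f := fun z => 1 / (z + conj w) ^ (ℓ + 2)) ?_
    fun z hz => kernelFun_apply hz
  refine DifferentiableOn.div (by fun_prop) (by fun_prop) fun z hz => ?_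
  exact pow_ne_zero _ (ne_zero_of_mem_rightHalfPlane (add_conj_mem_rightHalfPlane hz hw))

theorem lintegral_bergmanMeasure (ℓ : ℕ) (G : ℂ → ℝ≥0∞) :
    ∫⁻ z, G z ∂(bergmanMeasure ℓ) =
      ∫⁻ z in rightHalfPlane, ENNReal.ofReal (z.re ^ ℓ / Real.pi) * G z := by
  rw [bergmanMeasure, lintegral_withDensity_eq_lintegral_mul_non_measurable _
    BergmanSpace.measurable_density (Eventually.of_forall fun _ => ENNReal.ofReal_lt_top)]
  rfl

theorem integral_bergmanMeasure (ℓ : ℕ) (G : ℂ → ℂ) :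
    ∫ z, G z ∂(bergmanMeasure ℓ) = ∫ z in rightHalfPlane, (z.re ^ ℓ / Real.pi) • G z := by
  rw [bergmanMeasure, integral_withDensity_eq_integral_toReal_smul BergmanSpace.measurable_density
      (Eventually.of_forall fun _ => ENNReal.ofReal_lt_top)]
  refine setIntegral_congr_fun BergmanSpace.isOpen_rightHalfPlane.measurableSet fun z hz => ?_
  have hz' : 0 < z.re := hz
  rw [ENNReal.toReal_ofReal (by positivity)]

theorem integrable_bergmanMeasure_iff (ℓ : ℕ) (G : ℂ → ℂ) :
    Integrable G (bergmanMeasure ℓ) ↔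
      IntegrableOn (fun z => (z.re ^ ℓ / Real.pi) • G z) rightHalfPlane := by
  rw [bergmanMeasure, integrable_withDensity_iff_integrable_smul' BergmanSpace.measurable_density
      (Eventually.of_forall fun _ => ENNReal.ofReal_lt_top)]
  refine integrableOn_congr_fun (fun z hz => ?_)
    BergmanSpace.isOpen_rightHalfPlane.measurableSet
  have hz' : 0 < z.re := hz
  rw [ENNReal.toReal_ofReal (by positivity)]

theorem memLp_two_bergmanMeasure_iff {ℓ : ℕ} {h : ℂ → ℂ}
    (hh : DifferentiableOn ℂ h rightHalfPlane) :
    MemLp h 2 (bergmanMeasure ℓ) ↔ ∫⁻ z, ‖h z‖ₑ ^ 2 ∂(bergmanMeasure ℓ) < ∞ := by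
  have hm : AEStronglyMeasurable h (bergmanMeasure ℓ) :=
    (hh.continuousOn.aestronglyMeasurable
      BergmanSpace.isOpen_rightHalfPlane.measurableSet).mono_ac
      (withDensity_absolutelyContinuous _ _)
  have h5 := eLpNorm_nnreal_pow_eq_lintegral (f := h) (μ := bergmanMeasure ℓ)
    (p := 2) (by norm_num)
  have h6 : eLpNorm h 2 (bergmanMeasure ℓ) ^ 2 = ∫⁻ z, ‖h z‖ₑ ^ 2 ∂(bergmanMeasure ℓ) := by
    simpa using h5
  rw [← h6, MemLp, and_iff_right hm]
  constructor
  · intro h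
    exact ENNReal.pow_lt_top h
  · intro h
    rwa [ENNReal.pow_lt_top_iff, or_iff_left two_ne_zero] at h

/-- In the disc coordinate all powers of |1 - u| cancel in weight times Jacobian times squared
kernel. What remains is a constant times (1 - |u|²)^ℓ ≤ 1 on a set of finite measure. -/
theorem memLp_kernelFun (ℓ : ℕ) {w : ℂ} (hw : w ∈ rightHalfPlane) :
    MemLp (kernelFun ℓ w) 2 (bergmanMeasure ℓ) := by
  have hw' : 0 < w.re := hw
  rw [memLp_two_bergmanMeasure_iff (differentiableOn_kernelFun ℓ hw), lintegral_bergmanMeasure,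
    ← cayley_image hw, lintegral_image_holomorphic measurableSet_ball
      (fun u hu => hasDerivAt_cayley w hu) (injOn_cayley hw)]
  refine lt_of_le_of_lt (setLIntegral_mono' (g := fun _ => ENNReal.ofReal
    ((2 * w.re) ^ 2 * (w.re ^ ℓ / Real.pi) * (1 / (2 * w.re) ^ (ℓ + 2)) ^ 2))
    measurableSet_ball fun u hu => ?_) ?_
  · rw [kernelFun_apply (cayley_mem hw hu), cayley_add_conj w hu, cayley_re w hu, ← ofReal_norm,
      ← ENNReal.ofReal_pow (norm_nonneg _), ← ENNReal.ofReal_mul (by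
        have := cayley_mem hw hu
        rw [rightHalfPlane, mem_ofPred_eq, cayley_re w hu] at this
        positivity), ← ENNReal.ofReal_mul (by positivity)]
    refine ENNReal.ofReal_le_ofReal ?_
    have h0 : 0 < ‖1 - u‖ := norm_pos_iff.mpr (one_sub_ne_zero_of_mem_ball hu)
    rw [mem_ball_zero_iff] at hu
    have h1 : 0 ≤ 1 - ‖u‖ ^ 2 := by nlinarith [norm_nonneg u]
    have h2 : (1 - ‖u‖ ^ 2) ^ ℓ ≤ 1 := pow_le_one₀ h1 (by nlinarith [norm_nonneg u])
    simp only [norm_div, norm_pow, norm_one, Complex.norm_real, Real.norm_eq_abs]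
    rw [abs_of_pos (by positivity : (0 : ℝ) < 2 * w.re)]
    calc _ = (2 * w.re) ^ 2 * (w.re ^ ℓ / Real.pi) * (1 / (2 * w.re) ^ (ℓ + 2)) ^ 2 *
          (1 - ‖u‖ ^ 2) ^ ℓ := by
          generalize 1 - ‖u‖ ^ 2 = t at *
          generalize ‖1 - u‖ = s at *
          simp only [div_pow, mul_pow]
          field_simp
          ring
      _ ≤ _ := mul_le_of_le_one_right (by positivity) h2
  · rw [setLIntegral_const]
    exact ENNReal.mul_lt_top ENNReal.ofReal_lt_top measure_ball_lt_top

/-- The multiple `z ↦ 1 / (z + conj w) ^ (ℓ + 2)` of the reproducing kernel of `A²_ℓ` at `w`. -/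
noncomputable def bergmanKernel (ℓ : ℕ) {w : ℂ} (hw : w ∈ rightHalfPlane) : BergmanSpace ℓ :=
  ⟨kernelFun ℓ w, differentiableOn_kernelFun ℓ hw, fun _ hz => indicator_of_notMem hz _,
    memLp_kernelFun ℓ hw⟩

/-- The constant by which `bergmanKernel` reproduces. -/
noncomputable def kernelConst (ℓ : ℕ) : ℝ :=
  ∫ ρ in Ioo (0 : ℝ) 1, ρ * ((1 - ρ ^ 2) ^ ℓ / (2 ^ ℓ * Real.pi)) * (2 * Real.pi)

/-- The value of the constant plays no role; it only has to be nonzero so that it can be cancelled.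
-/
theorem kernelConst_pos (ℓ : ℕ) : 0 < kernelConst ℓ := by
  rw [kernelConst, ← integral_Ioc_eq_integral_Ioo, ← intervalIntegral.integral_of_le zero_le_one]
  refine intervalIntegral.intervalIntegral_pos_of_pos_on
    (Continuous.intervalIntegrable (by fun_prop) _ _) (fun ρ hρ => ?_) one_pos
  have h1 : 0 < ρ := hρ.1
  have h2 : 0 < 1 - ρ ^ 2 := by nlinarith [hρ.2]
  positivity

/-- Pulled back to the disc, the integrand is a radial weight times the holomorphic function F(u) =
h(cayley w u)/(1 - u)^(ℓ + 2), and F(0) = h(w). The powers of Re w cancel as well, so the constant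
does not depend on w. -/
theorem inner_bergmanKernel (ℓ : ℕ) {w : ℂ} (hw : w ∈ rightHalfPlane) (h : BergmanSpace ℓ) :
    inner ℂ (bergmanKernel ℓ hw) h = (kernelConst ℓ : ℂ) * h w := by
  have hw' : 0 < w.re := hw
  set G : ℂ → ℂ := fun z => conj (kernelFun ℓ w z) * h z with hG
  change ∫ z, G z ∂(bergmanMeasure ℓ) = _
  have hint : Integrable G (bergmanMeasure ℓ) :=
    (memLp_kernelFun ℓ hw).star.integrable_mul h.memLp
  rw [integrable_bergmanMeasure_iff, ← cayley_image hw] at hint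
  have hint' := integrableOn_image_holomorphic measurableSet_ball
    (fun u hu => hasDerivAt_cayley w hu) (injOn_cayley hw) hint
  rw [integral_bergmanMeasure, ← cayley_image hw, integral_image_holomorphic measurableSet_ball
      (fun u hu => hasDerivAt_cayley w hu) (injOn_cayley hw)]
  set F : ℂ → ℂ := fun u => h (cayley w u) / (1 - u) ^ (ℓ + 2) with hF
  have key : ∀ u ∈ Metric.ball (0 : ℂ) 1,
      ‖((2 * w.re : ℝ) : ℂ) / (1 - u) ^ 2‖ ^ 2 • ((cayley w u).re ^ ℓ / Real.pi) •
        G (cayley w u) = ((1 - ‖u‖ ^ 2) ^ ℓ / (2 ^ ℓ * Real.pi)) • F u := by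
    intro u hu
    have h0 := one_sub_ne_zero_of_mem_ball hu
    have h1 : conj (1 - u) ≠ 0 := (map_ne_zero _).mpr h0
    simp only [hG, hF]
    rw [kernelFun_apply (cayley_mem hw hu), cayley_add_conj w hu, cayley_re w hu, norm_div,
      norm_pow, Complex.norm_real, Real.norm_of_nonneg (by positivity)]
    have h2 : ((‖1 - u‖ : ℝ) : ℂ) ^ 2 = (1 - u) * conj (1 - u) := (Complex.mul_conj' _).symm
    have h3 : (w.re : ℂ) ≠ 0 := Complex.ofReal_ne_zero.mpr hw'.ne'
    have h4 : (Real.pi : ℂ) ≠ 0 := Complex.ofReal_ne_zero.mpr Real.pi_ne_zero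
    simp only [Complex.real_smul, map_div₀, map_pow, Complex.conj_ofReal, map_one]
    push_cast
    simp only [h2]
    -- With |1 - u|² written as a product of conjugates, this is a rational identity in two
    -- independent variables.
    generalize conj (1 - u) = v at *
    generalize 1 - u = u' at *
    simp only [div_pow, mul_pow]
    field_simp
    ring
  have hFd : DifferentiableOn ℂ F (Metric.ball 0 1) := by
    refine DifferentiableOn.div ?_ (by fun_prop) fun u hu =>
      pow_ne_zero _ (one_sub_ne_zero_of_mem_ball hu)
    exact h.2.1.comp (fun u hu =>
      (hasDerivAt_cayley w hu).differentiableAt.differentiableWithinAt) fun u hu =>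
      cayley_mem hw hu
  rw [setIntegral_congr_fun measurableSet_ball key,
    integral_ball_radial_smul (fun ρ => (1 - ρ ^ 2) ^ ℓ / (2 ^ ℓ * Real.pi)) (by fun_prop) hFd
      ((integrableOn_congr_fun key measurableSet_ball).mp hint')]
  rw [← kernelConst, Complex.real_smul]
  simp [hF, cayley]

/-! ### Hermitian operators and the functional equation -/

/-- The functional equation of the symbols that says that the weighted composition operator and
its adjoint agree on the reproducing kernels. -/
def KernelSymmetric (n : ℕ) (f g : ℂ → ℂ) : Prop :=
  ∀ z ∈ rightHalfPlane, ∀ w ∈ rightHalfPlane,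
    f z * (z + conj (g w)) ^ n = conj (f w) * (g z + conj w) ^ n

theorem weightedComp_apply {f g h : ℂ → ℂ} {z : ℂ} (hz : z ∈ rightHalfPlane) :
    weightedComp f g h z = f z * h (g z) := indicator_of_mem hz _

theorem inner_smul_bergmanKernel {ℓ : ℕ} {w : ℂ} (hw : w ∈ rightHalfPlane) (c : ℂ)
    (h : BergmanSpace ℓ) :
    inner ℂ (conj c • bergmanKernel ℓ hw) h = (kernelConst ℓ : ℂ) * (c * h w) := by
  rw [inner_smul_left, inner_bergmanKernel, Complex.conj_conj]
  ring

theorem smul_bergmanKernel_apply {ℓ : ℕ} {w z : ℂ} (hw : w ∈ rightHalfPlane)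
    (hz : z ∈ rightHalfPlane) (c : ℂ) :
    (c • bergmanKernel ℓ hw : BergmanSpace ℓ) z = c * (1 / (z + conj w) ^ (ℓ + 2)) := by
  rw [← kernelFun_apply hz]
  rfl

/-- The functional h ↦ f(w) h(g(w)) is represented by a multiple of the kernel at g(w), so the
kernel at w lies in the domain of the adjoint. Equality of domains puts it in the domain of the
operator itself, where its image can be computed directly and compared. -/
theorem IsSelfAdjoint.kernelSymmetric {ℓ : ℕ} {f g : ℂ → ℂ}
    (hmaps : MapsTo g rightHalfPlane rightHalfPlane)
    (hT : IsSelfAdjoint (maxWeightedComp ℓ f g)) : KernelSymmetric (ℓ + 2) f g := by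
  intro z hz w hw
  have hdense := hT.dense_domain
  rw [LinearPMap.isSelfAdjoint_def] at hT
  have hrep : ∀ h : (maxWeightedComp ℓ f g).domain,
      inner ℂ (conj (f w) • bergmanKernel ℓ (hmaps hw)) (h : BergmanSpace ℓ) =
        inner ℂ (bergmanKernel ℓ hw) (maxWeightedComp ℓ f g h) := by
    intro h
    rw [inner_smul_bergmanKernel, inner_bergmanKernel]
    congr 1
    exact (weightedComp_apply hw).symm
  have hmem : bergmanKernel ℓ hw ∈ (maxWeightedComp ℓ f g).adjoint.domain :=
    LinearPMap.mem_adjoint_domain_of_exists _ ⟨_, hrep⟩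
  have heq := LinearPMap.adjoint_apply_eq hdense ⟨_, hmem⟩ hrep
  have hmem' : bergmanKernel ℓ hw ∈ (maxWeightedComp ℓ f g).domain := by rwa [hT] at hmem
  have heq' : maxWeightedComp ℓ f g ⟨bergmanKernel ℓ hw, hmem'⟩ =
      conj (f w) • bergmanKernel ℓ (hmaps hw) := by
    rw [← heq]
    exact ((LinearPMap.ext_iff.mp hT).2 (hf := hmem) (hg := hmem')).symm
  have h1 : weightedComp f g (kernelFun ℓ w) z =
      (conj (f w) • bergmanKernel ℓ (hmaps hw) : BergmanSpace ℓ) z := by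
    rw [← heq']
    rfl
  rw [weightedComp_apply hz, kernelFun_apply (hmaps hz), smul_bergmanKernel_apply (hmaps hw) hz]
    at h1
  have h2 := ne_zero_of_mem_rightHalfPlane (add_conj_mem_rightHalfPlane hz (hmaps hw))
  have h3 := ne_zero_of_mem_rightHalfPlane (add_conj_mem_rightHalfPlane (hmaps hz) hw)
  field_simp at h1
  rw [h1, mul_comm]

/-- A bounded weighted composition operator whose symbols satisfy the functional equation is
hermitian. -/
theorem KernelSymmetric.isSelfAdjoint {ℓ : ℕ} {f g : ℂ → ℂ}
    (hmaps : MapsTo g rightHalfPlane rightHalfPlane) (hsymm : KernelSymmetric (ℓ + 2) f g)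
    (hb : IsBoundedOperator (maxWeightedComp ℓ f g)) : IsSelfAdjoint (maxWeightedComp ℓ f g) := by
  obtain ⟨htop, L, -, hL⟩ := hb
  have hmem : ∀ h : BergmanSpace ℓ, h ∈ (maxWeightedComp ℓ f g).domain := fun h => by
    rw [htop]; exact Submodule.mem_top
  let B₀ : BergmanSpace ℓ →ₗ[ℂ] BergmanSpace ℓ :=
    { toFun := fun h => maxWeightedComp ℓ f g ⟨h, hmem h⟩
      map_add' := fun h k =>
        LinearPMap.map_add (maxWeightedComp ℓ f g) ⟨h, hmem h⟩ ⟨k, hmem k⟩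
      map_smul' := fun c h => LinearPMap.map_smul (maxWeightedComp ℓ f g) c ⟨h, hmem h⟩ }
  let B : BergmanSpace ℓ →L[ℂ] BergmanSpace ℓ := B₀.mkContinuous L fun h => hL ⟨h, hmem h⟩
  have hBz : ∀ (h : BergmanSpace ℓ) (z : ℂ), B h z = weightedComp f g h z := fun _ _ => rfl
  have hBk : ∀ {w : ℂ} (hw : w ∈ rightHalfPlane),
      B (bergmanKernel ℓ hw) = conj (f w) • bergmanKernel ℓ (hmaps hw) := by
    intro w hw
    refine BergmanSpace.ext fun z => ?_
    by_cases hz : z ∈ rightHalfPlane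
    · have h2 := ne_zero_of_mem_rightHalfPlane (add_conj_mem_rightHalfPlane hz (hmaps hw))
      have h3 := ne_zero_of_mem_rightHalfPlane (add_conj_mem_rightHalfPlane (hmaps hz) hw)
      rw [hBz, weightedComp_apply hz, smul_bergmanKernel_apply (hmaps hw) hz]
      change f z * kernelFun ℓ w (g z) = _
      rw [kernelFun_apply (hmaps hz)]
      have := hsymm z hz w hw
      field_simp
      rw [this, mul_comm]
    · rw [(B (bergmanKernel ℓ hw)).2.2.1 z hz,
        (conj (f w) • bergmanKernel ℓ (hmaps hw) : BergmanSpace ℓ).2.2.1 z hz]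
  -- Pairing with the kernel at w evaluates both sides at w, and the action of B on kernels is
  -- known.
  have hadj : ContinuousLinearMap.adjoint B = B := by
    refine ContinuousLinearMap.ext fun h => BergmanSpace.ext fun w => ?_
    by_cases hw : w ∈ rightHalfPlane
    · have hM : (kernelConst ℓ : ℂ) ≠ 0 := Complex.ofReal_ne_zero.mpr (kernelConst_pos ℓ).ne'
      refine mul_left_cancel₀ hM ?_
      rw [← inner_bergmanKernel ℓ hw, ContinuousLinearMap.adjoint_inner_right, hBk hw,
        inner_smul_bergmanKernel, hBz, weightedComp_apply hw]
    · rw [(ContinuousLinearMap.adjoint B h).2.2.1 w hw, (B h).2.2.1 w hw]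
  have hTB : maxWeightedComp ℓ f g = (B : BergmanSpace ℓ →ₗ[ℂ] BergmanSpace ℓ).toPMap ⊤ :=
    LinearPMap.ext htop fun {x} hx hx' => rfl
  rw [LinearPMap.isSelfAdjoint_def, hTB,
    ContinuousLinearMap.toPMap_adjoint_eq_adjoint_toPMap_of_dense B dense_univ, hadj]

/-! ### Criteria for boundedness -/

theorem BergmanSpace.enorm_sq_eq {ℓ : ℕ} (h : BergmanSpace ℓ) :
    ‖h‖ₑ ^ 2 = ∫⁻ z, ‖h z‖ₑ ^ 2 ∂(bergmanMeasure ℓ) := by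
  have h4 : ‖h‖ₑ = eLpNorm h 2 (bergmanMeasure ℓ) := Lp.enorm_toLp (memLp h)
  have h5 := eLpNorm_nnreal_pow_eq_lintegral (f := h) (μ := bergmanMeasure ℓ)
    (p := 2) (by norm_num)
  simpa [h4] using h5

theorem isBoundedOperator_of_lintegral_le {ℓ : ℕ} {f g : ℂ → ℂ}
    (hf : DifferentiableOn ℂ f rightHalfPlane) (hg : DifferentiableOn ℂ g rightHalfPlane)
    (hmaps : MapsTo g rightHalfPlane rightHalfPlane) {C : ℝ} (hC : 0 ≤ C)
    (hbound : ∀ h : BergmanSpace ℓ,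
      ∫⁻ z, ‖weightedComp f g h z‖ₑ ^ 2 ∂(bergmanMeasure ℓ) ≤
        ENNReal.ofReal C * ‖h‖ₑ ^ 2) :
    IsBoundedOperator (maxWeightedComp ℓ f g) := by
  have hd : ∀ h : BergmanSpace ℓ, DifferentiableOn ℂ (weightedComp f g h) rightHalfPlane :=
    fun h => (hf.mul (h.2.1.comp hg hmaps)).congr fun z hz => weightedComp_apply hz
  have hmem : ∀ h : BergmanSpace ℓ, h ∈ (maxWeightedComp ℓ f g).domain := fun h => by
    refine ⟨hd h, fun z hz => indicator_of_notMem hz _, ?_⟩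
    rw [memLp_two_bergmanMeasure_iff (hd h)]
    exact (hbound h).trans_lt (ENNReal.mul_lt_top ENNReal.ofReal_lt_top
      (ENNReal.pow_lt_top enorm_lt_top))
  -- The summand 1 keeps the bound positive when C = 0.
  refine ⟨eq_top_iff.mpr fun h _ => hmem h, √C + 1, by positivity, fun h => ?_⟩
  have h1 := hbound h
  have h2 : ‖maxWeightedComp ℓ f g h‖ₑ ^ 2 =
      ∫⁻ z, ‖weightedComp f g h z‖ₑ ^ 2 ∂(bergmanMeasure ℓ) :=
    (maxWeightedComp ℓ f g h).enorm_sq_eq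
  rw [← h2, ← ofReal_norm, ← ofReal_norm, ← ENNReal.ofReal_pow (norm_nonneg _),
    ← ENNReal.ofReal_pow (norm_nonneg _), ← ENNReal.ofReal_mul hC,
    ENNReal.ofReal_le_ofReal_iff (by positivity)] at h1
  refine le_of_sq_le_sq ?_ (by positivity)
  refine h1.trans ?_
  rw [mul_pow]
  gcongr
  nlinarith [Real.sq_sqrt hC, Real.sqrt_nonneg C]

/-- Boundedness for an injective symbol `g`, by a change of variables. -/
theorem isBoundedOperator_of_injOn {ℓ : ℕ} {f g g' : ℂ → ℂ}
    (hf : DifferentiableOn ℂ f rightHalfPlane)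
    (hg : ∀ z ∈ rightHalfPlane, HasDerivAt g (g' z) z)
    (hmaps : MapsTo g rightHalfPlane rightHalfPlane) (hinj : InjOn g rightHalfPlane)
    {C : ℝ} (hC : 0 ≤ C)
    (hbound : ∀ z ∈ rightHalfPlane,
      z.re ^ ℓ * ‖f z‖ ^ 2 ≤ C * ((g z).re ^ ℓ * ‖g' z‖ ^ 2)) :
    IsBoundedOperator (maxWeightedComp ℓ f g) := by
  have hm := BergmanSpace.isOpen_rightHalfPlane.measurableSet
  refine isBoundedOperator_of_lintegral_le hf
    (fun z hz => (hg z hz).differentiableAt.differentiableWithinAt) hmaps hC fun h => ?_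
  rw [h.enorm_sq_eq, lintegral_bergmanMeasure, lintegral_bergmanMeasure]
  -- The norm of h is only diminished by integrating over the image of g, which g parametrizes
  -- injectively.
  refine le_trans ?_ (mul_le_mul_right (lintegral_mono_set hmaps.image_subset) _)
  rw [lintegral_image_holomorphic hm hg hinj, ← lintegral_const_mul' _ _ ENNReal.ofReal_ne_top]
  refine setLIntegral_mono' hm fun z hz => ?_
  have hz' : 0 < z.re := hz
  have hgz : 0 < (g z).re := hmaps hz
  rw [weightedComp_apply hz, enorm_mul, mul_pow, ← ofReal_norm, ← ofReal_norm,
    ← ENNReal.ofReal_pow (norm_nonneg _), ← ENNReal.ofReal_pow (norm_nonneg _),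
    ← ENNReal.ofReal_mul (by positivity), ← ENNReal.ofReal_mul (by positivity),
    ← ENNReal.ofReal_mul (by positivity), ← ENNReal.ofReal_mul (by positivity),
    ← ENNReal.ofReal_mul hC]
  refine ENNReal.ofReal_le_ofReal ?_
  have := mul_le_mul_of_nonneg_right (hbound z hz)
    (by positivity : 0 ≤ ‖h (g z)‖ ^ 2 / Real.pi)
  calc _ = z.re ^ ℓ * ‖f z‖ ^ 2 * (‖h (g z)‖ ^ 2 / Real.pi) := by ring
    _ ≤ _ := this
    _ = _ := by ring

/-! ### Solving the functional equation -/

theorem ofReal_mem_rightHalfPlane {t : ℝ} (ht : 0 < t) : (t : ℂ) ∈ rightHalfPlane := ht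

theorem one_mem_rightHalfPlane : (1 : ℂ) ∈ rightHalfPlane := by
  simp [rightHalfPlane]

/-- Once the functional equation is separated into a function of z and the conjugate of the same
function of w, this yields the real constants ε, λ and δ of the theorem. -/
theorem exists_real_const {φ : ℂ → ℂ}
    (h : ∀ z ∈ rightHalfPlane, ∀ w ∈ rightHalfPlane, φ z = conj (φ w)) :
    ∃ c : ℝ, ∀ z ∈ rightHalfPlane, φ z = c := by
  have h1 := one_mem_rightHalfPlane
  obtain ⟨c, hc⟩ := Complex.conj_eq_iff_real.mp (h 1 h1 1 h1).symm
  refine ⟨c, fun z hz => ?_⟩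
  rw [h z hz 1 h1, hc, Complex.conj_ofReal]

/-- The factor z + conj g(w) has positive real part. Hence f vanishes everywhere or nowhere, and in
the second case one may divide by it. -/
theorem KernelSymmetric.eq_zero_of_eq_zero {n : ℕ} {f g : ℂ → ℂ} (hsymm : KernelSymmetric n f g)
    (hmaps : MapsTo g rightHalfPlane rightHalfPlane) {w : ℂ} (hw : w ∈ rightHalfPlane)
    (h0 : f w = 0) : ∀ z ∈ rightHalfPlane, f z = 0 := by
  intro z hz
  have h := hsymm z hz w hw
  rw [h0, map_zero, zero_mul, mul_eq_zero] at h
  exact h.resolve_right (pow_ne_zero _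
    (ne_zero_of_mem_rightHalfPlane (add_conj_mem_rightHalfPlane hz (hmaps hw))))

/-- The logarithmic derivative in `z` of the functional equation. -/
theorem KernelSymmetric.logDeriv_eq {n : ℕ} {f g : ℂ → ℂ} (hn : n ≠ 0)
    (hf : DifferentiableOn ℂ f rightHalfPlane) (hg : DifferentiableOn ℂ g rightHalfPlane)
    (hmaps : MapsTo g rightHalfPlane rightHalfPlane) (hsymm : KernelSymmetric n f g)
    (hne : ∀ z ∈ rightHalfPlane, f z ≠ 0) {z w : ℂ} (hz : z ∈ rightHalfPlane)
    (hw : w ∈ rightHalfPlane) :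
    deriv f z / (n * f z) + 1 / (z + conj (g w)) = deriv g z / (g z + conj w) := by
  have hnhds := BergmanSpace.isOpen_rightHalfPlane.mem_nhds hz
  have hX := ne_zero_of_mem_rightHalfPlane (add_conj_mem_rightHalfPlane hz (hmaps hw))
  have hY := ne_zero_of_mem_rightHalfPlane (add_conj_mem_rightHalfPlane (hmaps hz) hw)
  have hf' := (hf.differentiableAt hnhds).hasDerivAt
  have hg' := (hg.differentiableAt hnhds).hasDerivAt
  have h1 := hf'.mul (((hasDerivAt_id z).add_const (conj (g w))).pow n)
  have h2 := ((hg'.add_const (conj w)).pow n).const_mul (conj (f w))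
  have h3 := h1.unique (h2.congr_of_eventuallyEq
    (eventually_of_mem hnhds fun u hu => hsymm u hu w hw))
  have h4 := hsymm z hz w hw
  obtain ⟨m, rfl⟩ := Nat.exists_eq_succ_of_ne_zero hn
  have hfz := hne z hz
  simp only [Pi.pow_apply, id_eq, Nat.succ_eq_add_one, Nat.add_sub_cancel] at h3
  have hm : ((m : ℂ) + 1) ≠ 0 := by exact_mod_cast Nat.succ_ne_zero m
  push_cast at h3 ⊢
  generalize g z + conj w = Y at *
  generalize z + conj (g w) = X at *
  have hXm : X ^ m ≠ 0 := pow_ne_zero _ hX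
  rw [div_add_div _ _ (mul_ne_zero hm hfz) hX, div_eq_div_iff (by positivity) hY]
  -- Multiplying the differentiated equation by Y restores the full power of Y, which the original
  -- equation trades for f(z) times that of X; the factor X^m then cancels.
  refine mul_left_cancel₀ hXm ?_
  rw [Nat.succ_eq_add_one] at h4
  linear_combination Y * h3 - (↑m + 1) * deriv g z * h4

theorem KernelSymmetric.symbols_of_eq_const {n : ℕ} {f g : ℂ → ℂ}
    (hsymm : KernelSymmetric n f g) {μ : ℂ} (hμ : μ ∈ rightHalfPlane)
    (hg : ∀ w ∈ rightHalfPlane, g w = μ) :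
    ∃ ε : ℝ, ∀ w ∈ rightHalfPlane, f w = (ε : ℂ) / (w + conj μ) ^ n := by
  obtain ⟨ε, hε⟩ := exists_real_const (φ := fun z => f z * (z + conj μ) ^ n) fun z hz w hw => by
    have := hsymm z hz w hw
    rw [hg z hz, hg w hw] at this
    simp only [this, map_mul, map_pow, map_add, Complex.conj_conj]
    ring
  refine ⟨ε, fun w hw => ?_⟩
  rw [eq_div_iff (pow_ne_zero _
    (ne_zero_of_mem_rightHalfPlane (add_conj_mem_rightHalfPlane hw hμ))), hε w hw]

/-- If Im p ≠ 0, moving along the line Re w = 1 brings the real part of the image to 0. So p is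
real, p = ±1, and p = -1 sends large positive numbers out of the half-plane. -/
theorem eq_one_of_affine_mapsTo {p q : ℂ} (hp : p * conj p = 1)
    (hmaps : ∀ w ∈ rightHalfPlane, p * w + q ∈ rightHalfPlane) : p = 1 := by
  have him : p.im = 0 := by
    by_contra h
    have h1 : ((1 : ℂ) + ((p.re + q.re) / p.im : ℝ) * Complex.I) ∈ rightHalfPlane := by
      simp [rightHalfPlane]
    have h2 : 0 < (p * ((1 : ℂ) + ((p.re + q.re) / p.im : ℝ) * Complex.I) + q).re := hmaps _ h1
    simp only [Complex.add_re, Complex.mul_re, Complex.add_im, Complex.mul_im, Complex.one_re,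
      Complex.one_im, Complex.ofReal_re, Complex.ofReal_im, Complex.I_re, Complex.I_im] at h2
    have h3 : p.im * ((p.re + q.re) / p.im) = p.re + q.re := mul_div_cancel₀ _ h
    linarith
  have hpr : p.re * p.re = 1 := by
    have := congrArg Complex.re hp
    simpa [him] using this
  have hre : p.re ≠ -1 := by
    intro h
    have h1 : ((|q.re| + 1 : ℝ) : ℂ) ∈ rightHalfPlane := ofReal_mem_rightHalfPlane (by positivity)
    have h2 : 0 < (p * ((|q.re| + 1 : ℝ) : ℂ) + q).re := hmaps _ h1
    simp only [Complex.add_re, Complex.re_mul_ofReal, h] at h2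
    linarith [le_abs_self q.re]
  refine Complex.ext ?_ him
  have : (p.re + 1) * (p.re - 1) = 0 := by linear_combination hpr
  rcases mul_eq_zero.mp this with h | h
  · exact absurd (by linarith) hre
  · simpa using sub_eq_zero.mp h

/-- A polynomial of degree two that vanishes on the half-plane has leading coefficient zero. -/
theorem leading_coeff_eq_zero {a b c : ℂ}
    (h : ∀ w ∈ rightHalfPlane, a * w ^ 2 + b * w + c = 0) : a = 0 ∧ b = 0 ∧ c = 0 := by
  have h1 := h ((1 : ℝ) : ℂ) (ofReal_mem_rightHalfPlane (by norm_num))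
  have h2 := h ((2 : ℝ) : ℂ) (ofReal_mem_rightHalfPlane (by norm_num))
  have h3 := h ((3 : ℝ) : ℂ) (ofReal_mem_rightHalfPlane (by norm_num))
  push_cast at h1 h2 h3
  refine ⟨?_, ?_, ?_⟩
  · linear_combination (h1 - 2 * h2 + h3) / 2
  · linear_combination (-5 * h1 + 8 * h2 - 3 * h3) / 2
  · linear_combination 3 * h1 - 3 * h2 + h3

theorem conj_mem_rightHalfPlane {w : ℂ} (hw : w ∈ rightHalfPlane) :
    conj w ∈ rightHalfPlane := by
  simpa [rightHalfPlane] using hw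

theorem KernelSymmetric.symbols_of_affine {n : ℕ} {f g : ℂ → ℂ} (hn : n ≠ 0)
    (hf : DifferentiableOn ℂ f rightHalfPlane) (hg : DifferentiableOn ℂ g rightHalfPlane)
    (hmaps : MapsTo g rightHalfPlane rightHalfPlane) (hsymm : KernelSymmetric n f g)
    (hne : ∀ z ∈ rightHalfPlane, f z ≠ 0) {p q : ℂ} (hp : p ≠ 0)
    (hgpq : ∀ w ∈ rightHalfPlane, g w = p * w + q) :
    ∃ γ lam : ℝ, 0 ≤ γ ∧ ∀ w ∈ rightHalfPlane, g w = w + (γ : ℂ) ∧ f w = (lam : ℂ) := by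
  have hone := one_mem_rightHalfPlane
  have hd : deriv g 1 = p := by
    have h1 : HasDerivAt (fun w : ℂ => p * w + q) p 1 := by
      simpa using ((hasDerivAt_id (1 : ℂ)).const_mul p).add_const q
    exact (h1.congr_of_eventuallyEq (eventually_of_mem
      (BergmanSpace.isOpen_rightHalfPlane.mem_nhds hone) hgpq)).deriv
  -- Using conj w in place of w makes the relation polynomial in w. Its three coefficients give in
  -- turn k = 0, |p| = 1 and, once p = 1, that q is real.
  have hkey := fun w (hw : w ∈ rightHalfPlane) =>
    hsymm.logDeriv_eq hn hf hg hmaps hne hone (conj_mem_rightHalfPlane hw)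
  rw [hd] at hkey
  set k := deriv f 1 / (n * f 1)
  have hpoly := leading_coeff_eq_zero (a := k * conj p)
    (b := k * (conj p * (p + q) + (1 + conj q)) + 1 - p * conj p)
    (c := k * (1 + conj q) * (p + q) + (p + q) - p * (1 + conj q)) fun w hw => by
      have hw' := conj_mem_rightHalfPlane hw
      have hX := ne_zero_of_mem_rightHalfPlane (add_conj_mem_rightHalfPlane hone (hmaps hw'))
      have hY := ne_zero_of_mem_rightHalfPlane (add_conj_mem_rightHalfPlane (hmaps hone) hw')
      have h := hkey w hw
      field_simp at h
      rw [hgpq _ hw', hgpq 1 hone] at h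
      simp only [map_add, map_mul, Complex.conj_conj] at h
      linear_combination h
  have hk : k = 0 :=
    (mul_eq_zero.mp hpoly.1).resolve_right ((map_ne_zero _).mpr hp)
  have hpp : p * conj p = 1 := by
    have := hpoly.2.1
    rw [hk] at this
    linear_combination -this
  have hp1 : p = 1 := eq_one_of_affine_mapsTo hpp fun w hw => by
    rw [← hgpq w hw]
    exact hmaps hw
  have hq : conj q = q := by
    have := hpoly.2.2
    rw [hk, hp1] at this
    linear_combination -this
  obtain ⟨γ, rfl⟩ := Complex.conj_eq_iff_real.mp hq
  subst hp1
  obtain ⟨lam, hlam⟩ := exists_real_const (φ := f) fun z hz w hw => by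
    have := hsymm z hz w hw
    rw [hgpq z hz, hgpq w hw] at this
    have hX := ne_zero_of_mem_rightHalfPlane (add_conj_mem_rightHalfPlane hz (hmaps hw))
    rw [hgpq w hw] at hX
    rw [show 1 * z + (γ : ℂ) + conj w = z + conj (1 * w + (γ : ℂ)) by
      simp only [map_add, map_mul, map_one, Complex.conj_ofReal]; ring] at this
    exact mul_right_cancel₀ (pow_ne_zero _ hX) this
  refine ⟨γ, lam, ?_, fun w hw => ⟨by rw [hgpq w hw, one_mul], hlam w hw⟩⟩
  by_contra hγ
  -- For γ < 0 the point -γ of the half-plane would be mapped to 0.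
  have h1 : ((-γ : ℝ) : ℂ) ∈ rightHalfPlane := ofReal_mem_rightHalfPlane (by linarith)
  have h2 := hmaps h1
  rw [hgpq _ h1] at h2
  refine ne_zero_of_mem_rightHalfPlane h2 ?_
  push_cast
  ring

/-- For fixed z the logarithmic derivative is a polynomial identity in conj w. Eliminating k and
g'(z) from its two top coefficients leaves conj B (z - D)² = B (z + conj A)². As an identity in z
this forces B to be real and D = -conj A. -/
theorem KernelSymmetric.symbols_of_moebius {n : ℕ} {f g : ℂ → ℂ} (hn : n ≠ 0)
    (hf : DifferentiableOn ℂ f rightHalfPlane) (hg : DifferentiableOn ℂ g rightHalfPlane)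
    (hmaps : MapsTo g rightHalfPlane rightHalfPlane) (hsymm : KernelSymmetric n f g)
    (hne : ∀ z ∈ rightHalfPlane, f z ≠ 0) {A B D : ℂ} (hB : B ≠ 0)
    (hD : ∀ w ∈ rightHalfPlane, w - D ≠ 0)
    (hgABD : ∀ w ∈ rightHalfPlane, g w = A + B / (w - D)) :
    ∃ b c : ℝ, b ≠ 0 ∧ c ≠ 0 ∧ 0 ≤ A.re ∧ (b < 0 → 0 < A.re ∧ -b ≤ A.re ^ 2) ∧
      ∀ w ∈ rightHalfPlane, g w = A + b / (w + conj A) ∧ f w = (c : ℂ) / (w + conj A) ^ n := by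
  have hone := one_mem_rightHalfPlane
  have hd : ∀ z ∈ rightHalfPlane, deriv g z = -B / (z - D) ^ 2 := by
    intro z hz
    have h1 : HasDerivAt (fun w : ℂ => A + B / (w - D)) (-B / (z - D) ^ 2) z := by
      have h2 := ((hasDerivAt_const z B).div ((hasDerivAt_id z).sub_const D) (hD z hz)).const_add A
      convert! h2 using 1
      simp
    exact (h1.congr_of_eventuallyEq (eventually_of_mem
      (BergmanSpace.isOpen_rightHalfPlane.mem_nhds hz) hgABD)).deriv
  have hcoef : ∀ z ∈ rightHalfPlane, conj B * (z - D) ^ 2 = B * (z + conj A) ^ 2 := by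
    intro z hz
    set k := deriv f z / (n * f z) with hk
    have hpoly := leading_coeff_eq_zero (a := k * (z + conj A) + 1)
      (b := k * ((z + conj A) * (g z - conj D) + conj B) + g z - conj D
        - deriv g z * (z + conj A))
      (c := (k * (conj B - (z + conj A) * conj D) - conj D) * g z
        - deriv g z * (conj B - (z + conj A) * conj D)) fun w hw => by
        have hw' := conj_mem_rightHalfPlane hw
        have hX := ne_zero_of_mem_rightHalfPlane (add_conj_mem_rightHalfPlane hz (hmaps hw'))
        have hY := ne_zero_of_mem_rightHalfPlane (add_conj_mem_rightHalfPlane (hmaps hz) hw')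
        have h := hsymm.logDeriv_eq hn hf hg hmaps hne hz hw'
        have hs : w - conj D ≠ 0 := fun h0 => hD _ hw' (by
          simpa using congrArg conj h0)
        have hXs : (z + conj (g (conj w))) * (w - conj D) =
            (z + conj A) * (w - conj D) + conj B := by
          rw [hgABD _ hw']
          simp only [map_add, map_div₀, map_sub, Complex.conj_conj]
          field_simp
          ring
        rw [Complex.conj_conj] at h hY
        rw [← hk, add_div' _ _ _ hX, div_eq_div_iff hX hY] at h
        linear_combination (w - conj D) * h + (deriv g z - k * (g z + w)) * hXs
    obtain ⟨h1, h2, -⟩ := hpoly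
    have h3 : k * conj B = deriv g z * (z + conj A) := by
      linear_combination h2 - (g z - conj D) * h1
    have h4 : deriv g z * (z - D) ^ 2 = -B := by
      rw [hd z hz, div_mul_cancel₀ _ (pow_ne_zero _ (hD z hz))]
    linear_combination -(z - D) ^ 2 * (z + conj A) * h3 + (z - D) ^ 2 * conj B * h1
      - (z + conj A) ^ 2 * h4
  have hpoly := leading_coeff_eq_zero (a := conj B - B) (b := -2 * (conj B * D + B * conj A))
    (c := conj B * D ^ 2 - B * conj A ^ 2) fun z hz => by linear_combination hcoef z hz
  have hBr : conj B = B := sub_eq_zero.mp hpoly.1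
  have hDA : D = -conj A := by
    have := hpoly.2.1
    rw [hBr] at this
    refine mul_left_cancel₀ hB ?_
    linear_combination -this / 2
  obtain ⟨b, rfl⟩ := Complex.conj_eq_iff_real.mp hBr
  subst hDA
  simp only [sub_neg_eq_add] at hD hgABD
  have hb : b ≠ 0 := Complex.ofReal_ne_zero.mp hB
  obtain ⟨c, hc⟩ := exists_real_const (φ := fun z => f z * (z + conj A) ^ n) fun z hz w hw => by
    have h := hsymm z hz w hw
    have hX := ne_zero_of_mem_rightHalfPlane (add_conj_mem_rightHalfPlane hz (hmaps hw))
    have hz0 := hD z hz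
    have hw0 : conj w + A ≠ 0 := fun h0 => hD w hw (by simpa using congrArg conj h0)
    -- The two bases of the functional equation are in the ratio z + conj A to conj w + A, so the
    -- variables separate.
    have h1 : (z + conj (g w)) * (conj w + A) = (g z + conj w) * (z + conj A) := by
      rw [hgABD z hz, hgABD w hw]
      simp only [map_add, map_div₀, Complex.conj_conj, Complex.conj_ofReal]
      field_simp
      ring
    simp only [map_mul, map_pow, map_add, Complex.conj_conj]
    refine mul_right_cancel₀ (pow_ne_zero n hX) ?_
    calc _ = f z * (z + conj (g w)) ^ n * (z + conj A) ^ n := by ring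
      _ = conj (f w) * ((g z + conj w) * (z + conj A)) ^ n := by rw [h, mul_pow]; ring
      _ = _ := by rw [← h1, mul_pow]; ring
  have hA : 0 ≤ A.re := by
    by_contra hA
    -- The pole of g cannot lie in the half-plane.
    have h1 : -conj A ∈ rightHalfPlane := by
      change 0 < (-conj A).re
      simp only [Complex.neg_re, Complex.conj_re]
      linarith
    exact hD _ h1 (by ring)
  refine ⟨b, c, hb, fun hc0 => ?_, hA, fun hb0 => ?_, fun w hw => ⟨hgABD w hw, ?_⟩⟩
  · have h1 := hc 1 hone
    rw [hc0, Complex.ofReal_zero] at h1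
    exact mul_ne_zero (hne 1 hone) (pow_ne_zero _ (hD 1 hone)) h1
  -- On the ray Im z = Im A the denominator z + conj A is the real number x + Re A, and Re g > 0
  -- becomes a linear inequality in x.
  · have hpos : ∀ x : ℝ, 0 < x → 0 < A.re * (x + A.re) + b := by
      intro x hx
      have h1 : (x + A.im * Complex.I : ℂ) ∈ rightHalfPlane := by
        simpa [rightHalfPlane] using hx
      have h2 : 0 < (g (x + A.im * Complex.I)).re := hmaps h1
      have h3 : (x + A.im * Complex.I : ℂ) + conj A = ((x + A.re : ℝ) : ℂ) := by
        apply Complex.ext <;> simp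
      have h4 : 0 < x + A.re := by linarith
      rw [hgABD _ h1, h3, ← Complex.ofReal_div, Complex.add_re, Complex.ofReal_re,
        ← sub_neg_eq_add, sub_pos, ← neg_div, div_lt_iff₀ h4] at h2
      linarith
    have hA' : 0 < A.re := by
      refine lt_of_le_of_ne hA fun h => ?_
      have := hpos 1 one_pos
      rw [← h] at this
      linarith
    refine ⟨hA', ?_⟩
    by_contra! h
    -- The zero of the linear expression, which is positive exactly when -b > (Re A)².
    have h1 := hpos ((-b - A.re ^ 2) / A.re) (div_pos (by linarith) hA')
    have h2 : A.re * ((-b - A.re ^ 2) / A.re + A.re) + b = 0 := by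
      field_simp
      ring
    linarith
  · rw [eq_div_iff (pow_ne_zero _ (hD w hw)), hc w hw]

theorem KernelSymmetric.classification {n : ℕ} {f g : ℂ → ℂ} (hn : n ≠ 0)
    (hf : DifferentiableOn ℂ f rightHalfPlane) (hg : DifferentiableOn ℂ g rightHalfPlane)
    (hmaps : MapsTo g rightHalfPlane rightHalfPlane) (hsymm : KernelSymmetric n f g) :
    (∀ w ∈ rightHalfPlane, f w = 0) ∨
    (∃ (μ : ℂ) (ε : ℝ), μ ∈ rightHalfPlane ∧
      ∀ w ∈ rightHalfPlane, g w = μ ∧ f w = (ε : ℂ) / (w + conj μ) ^ n) ∨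
    (∃ γ lam : ℝ, 0 ≤ γ ∧ ∀ w ∈ rightHalfPlane, g w = w + (γ : ℂ) ∧ f w = (lam : ℂ)) ∨
    ∃ (A : ℂ) (b c : ℝ), b ≠ 0 ∧ c ≠ 0 ∧ 0 ≤ A.re ∧ (b < 0 → 0 < A.re ∧ -b ≤ A.re ^ 2) ∧
      ∀ w ∈ rightHalfPlane, g w = A + b / (w + conj A) ∧ f w = (c : ℂ) / (w + conj A) ^ n := by
  have hone := one_mem_rightHalfPlane
  by_cases h0 : ∃ w ∈ rightHalfPlane, f w = 0
  · obtain ⟨w, hw, h0⟩ := h0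
    exact Or.inl (hsymm.eq_zero_of_eq_zero hmaps hw h0)
  have hne : ∀ z ∈ rightHalfPlane, f z ≠ 0 := fun z hz h => h0 ⟨z, hz, h⟩
  refine Or.inr ?_
  have hkey := fun w (hw : w ∈ rightHalfPlane) =>
    hsymm.logDeriv_eq hn hf hg hmaps hne hone hw
  generalize deriv f 1 / (n * f 1) = k at hkey
  generalize deriv g 1 = a at hkey
  set b := g 1
  have hX := fun w (hw : w ∈ rightHalfPlane) =>
    ne_zero_of_mem_rightHalfPlane (add_conj_mem_rightHalfPlane hone (hmaps hw))
  have hY := fun w (hw : w ∈ rightHalfPlane) =>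
    ne_zero_of_mem_rightHalfPlane (add_conj_mem_rightHalfPlane (hmaps hone) hw)
  by_cases ha : a = 0
  · left
    have hg1 : ∀ w ∈ rightHalfPlane, g w = b := by
      intro w hw
      have h1 := hkey w hw
      have h2 := hkey 1 hone
      rw [ha, zero_div] at h1 h2
      have h3 : (1 + conj (g w))⁻¹ = (1 + conj (g 1))⁻¹ := by
        rw [← one_div, ← one_div]
        linear_combination h1 - h2
      exact (starRingEnd ℂ).injective (add_left_cancel (inv_injective h3))
    obtain ⟨ε, hε⟩ := hsymm.symbols_of_eq_const (hmaps hone) hg1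
    exact ⟨b, ε, hmaps hone, fun w hw => ⟨hg1 w hw, hε w hw⟩⟩
  right
  by_cases hk : k = 0
  · left
    -- From conj g(w) = (b + conj w)/a - 1.
    refine hsymm.symbols_of_affine hn hf hg hmaps hne (p := conj (1 / a)) (q := conj (b / a) - 1)
      ((map_ne_zero _).mpr (one_div_ne_zero ha)) fun w hw => ?_
    have h1 := hkey w hw
    have hX' := hX w hw
    have hY' := hY w hw
    change b + conj w ≠ 0 at hY'
    rw [hk, zero_add, div_eq_div_iff hX' hY'] at h1
    apply (starRingEnd ℂ).injective
    simp only [map_add, map_mul, map_sub, map_one, Complex.conj_conj]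
    field_simp
    linear_combination -h1
  · right
    have hs : ∀ w ∈ rightHalfPlane, (a - k * (b + conj w)) * (1 + conj (g w)) = b + conj w := by
      intro w hw
      have h1 := hkey w hw
      have hX' := hX w hw
      have hY' : b + conj w ≠ 0 := hY w hw
      change k + 1 / (1 + conj (g w)) = a / (b + conj w) at h1
      field_simp at h1
      linear_combination -h1
    have hs' : ∀ w ∈ rightHalfPlane, a - k * (b + conj w) ≠ 0 := fun w hw h => by
      have h1 := hs w hw
      rw [h, zero_mul] at h1
      exact hY w hw h1.symm
    have hD : ∀ w ∈ rightHalfPlane, k * (conj w - (a - k * b) / k) ≠ 0 := fun w hw h => by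
      refine hs' w hw ?_
      field_simp at h
      linear_combination -h
    -- The conjugated coefficients of the partial fraction conj g(w) = -1/k - 1 - (a/k²)/(conj w -
    -- (a - k b)/k).
    refine ⟨conj (-1 / k - 1), hsymm.symbols_of_moebius hn hf hg hmaps hne
      (B := conj (-a / k ^ 2)) (D := conj ((a - k * b) / k)) ?_ (fun w hw h => ?_)
      fun w hw => ?_⟩
    · exact (map_ne_zero _).mpr (div_ne_zero (neg_ne_zero.mpr ha) (pow_ne_zero _ hk))
    · refine hD w hw ?_
      have := congrArg conj h
      simp only [map_sub, Complex.conj_conj, map_zero] at this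
      rw [this, mul_zero]
    · apply (starRingEnd ℂ).injective
      have h1 := hs w hw
      have h2 := right_ne_zero_of_mul (hD w hw)
      simp only [map_add, map_sub, map_div₀, Complex.conj_conj]
      rw [← sub_eq_iff_eq_add', eq_div_iff h2]
      field_simp
      linear_combination -k * h1

/-! ### The converse: symmetry and boundedness of each family -/

theorem kernelSymmetric_of_eq_zero {n : ℕ} {f g : ℂ → ℂ} (hf : ∀ w ∈ rightHalfPlane, f w = 0) :
    KernelSymmetric n f g := fun z hz w hw => by
  rw [hf z hz, hf w hw, map_zero, zero_mul, zero_mul]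

theorem isBoundedOperator_of_eq_zero {ℓ : ℕ} {f g : ℂ → ℂ}
    (hf : DifferentiableOn ℂ f rightHalfPlane) (hg : DifferentiableOn ℂ g rightHalfPlane)
    (hmaps : MapsTo g rightHalfPlane rightHalfPlane) (h0 : ∀ w ∈ rightHalfPlane, f w = 0) :
    IsBoundedOperator (maxWeightedComp ℓ f g) := by
  refine isBoundedOperator_of_lintegral_le hf hg hmaps le_rfl fun h => ?_
  have h1 : weightedComp f g h = 0 := by
    ext z
    by_cases hz : z ∈ rightHalfPlane <;> simp [weightedComp, hz]
    simp [h0 z hz]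
  simp [h1]

theorem kernelSymmetric_of_const {n : ℕ} {f g : ℂ → ℂ} {μ : ℂ} {ε : ℝ} (hμ : μ ∈ rightHalfPlane)
    (h : ∀ w ∈ rightHalfPlane, g w = μ ∧ f w = (ε : ℂ) / (w + conj μ) ^ n) :
    KernelSymmetric n f g := fun z hz w hw => by
  have h1 := ne_zero_of_mem_rightHalfPlane (add_conj_mem_rightHalfPlane hz hμ)
  have h2 := ne_zero_of_mem_rightHalfPlane (add_conj_mem_rightHalfPlane hμ hw)
  rw [(h z hz).1, (h w hw).1, (h z hz).2, (h w hw).2]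
  simp only [map_div₀, map_pow, map_add, Complex.conj_conj, Complex.conj_ofReal]
  rw [div_mul_cancel₀ _ (pow_ne_zero _ h1), add_comm (conj w), div_mul_cancel₀ _ (pow_ne_zero _ h2)]

/-- The operator has rank at most one: h ↦ ε h(μ) k_μ with k_μ the kernel at μ, and point evaluation
is bounded. -/
theorem isBoundedOperator_of_const {ℓ : ℕ} {f g : ℂ → ℂ} {μ : ℂ} {ε : ℝ}
    (hf : DifferentiableOn ℂ f rightHalfPlane) (hg : DifferentiableOn ℂ g rightHalfPlane)
    (hmaps : MapsTo g rightHalfPlane rightHalfPlane) (hμ : μ ∈ rightHalfPlane)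
    (hfg : ∀ w ∈ rightHalfPlane, g w = μ ∧ f w = (ε : ℂ) / (w + conj μ) ^ (ℓ + 2)) :
    IsBoundedOperator (maxWeightedComp ℓ f g) := by
  obtain ⟨C, r, hr, -, hC⟩ := BergmanSpace.exists_bound (ℓ := ℓ) hμ
  refine isBoundedOperator_of_lintegral_le hf hg hmaps
    (sq_nonneg (|ε| * C * ‖bergmanKernel ℓ hμ‖)) fun h => ?_
  have h1 : weightedComp f g h = ((ε * h μ : ℂ) • bergmanKernel ℓ hμ : BergmanSpace ℓ) := by
    ext z
    by_cases hz : z ∈ rightHalfPlane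
    · rw [weightedComp_apply hz, smul_bergmanKernel_apply hμ hz, (hfg z hz).1, (hfg z hz).2]
      ring
    · rw [((ε * h μ : ℂ) • bergmanKernel ℓ hμ : BergmanSpace ℓ).2.2.1 z hz]
      exact indicator_of_notMem hz _
  rw [h1, ← BergmanSpace.enorm_sq_eq, ← ofReal_norm, ← ofReal_norm,
    ← ENNReal.ofReal_pow (norm_nonneg _), ← ENNReal.ofReal_pow (norm_nonneg _),
    ← ENNReal.ofReal_mul (sq_nonneg _), ← mul_pow]
  refine ENNReal.ofReal_le_ofReal (pow_le_pow_left₀ (norm_nonneg _) ?_ 2)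
  rw [norm_smul, norm_mul, Complex.norm_real, Real.norm_eq_abs]
  have := hC h μ (Metric.mem_ball_self hr)
  calc _ ≤ |ε| * (C * ‖h‖) * ‖bergmanKernel ℓ hμ‖ := by gcongr
    _ = _ := by ring

theorem kernelSymmetric_of_translation {n : ℕ} {f g : ℂ → ℂ} {γ lam : ℝ}
    (h : ∀ w ∈ rightHalfPlane, g w = w + (γ : ℂ) ∧ f w = (lam : ℂ)) :
    KernelSymmetric n f g := fun z hz w hw => by
  rw [(h z hz).1, (h w hw).1, (h z hz).2, (h w hw).2]
  simp only [map_add, Complex.conj_ofReal]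
  ring

theorem isBoundedOperator_of_translation {ℓ : ℕ} {f g : ℂ → ℂ} {γ lam : ℝ}
    (hf : DifferentiableOn ℂ f rightHalfPlane)
    (hmaps : MapsTo g rightHalfPlane rightHalfPlane) (hγ : 0 ≤ γ)
    (hfg : ∀ w ∈ rightHalfPlane, g w = w + (γ : ℂ) ∧ f w = (lam : ℂ)) :
    IsBoundedOperator (maxWeightedComp ℓ f g) := by
  refine isBoundedOperator_of_injOn (g' := fun _ => 1) hf (fun z hz => ?_) hmaps
    (fun z hz w hw h => ?_) (sq_nonneg lam) fun z hz => ?_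
  · exact ((hasDerivAt_id z).add_const (γ : ℂ)).congr_of_eventuallyEq (eventually_of_mem
      (BergmanSpace.isOpen_rightHalfPlane.mem_nhds hz) fun w hw => (hfg w hw).1)
  · rw [(hfg z hz).1, (hfg w hw).1] at h
    exact add_right_cancel h
  · have hz' : 0 < z.re := hz
    rw [(hfg z hz).1, (hfg z hz).2, Complex.norm_real, Real.norm_eq_abs, sq_abs, norm_one,
      one_pow, mul_one, mul_comm, Complex.add_re, Complex.ofReal_re]
    gcongr
    linarith

theorem add_conj_ne_zero_of_nonneg {A z : ℂ} (hA : 0 ≤ A.re) (hz : z ∈ rightHalfPlane) :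
    z + conj A ≠ 0 := by
  have hz' : 0 < z.re := hz
  refine ne_zero_of_mem_rightHalfPlane ?_
  change 0 < (z + conj A).re
  simp only [Complex.add_re, Complex.conj_re]
  linarith

theorem kernelSymmetric_of_moebius {n : ℕ} {f g : ℂ → ℂ} {A : ℂ} {b c : ℝ} (hA : 0 ≤ A.re)
    (h : ∀ w ∈ rightHalfPlane, g w = A + b / (w + conj A) ∧ f w = (c : ℂ) / (w + conj A) ^ n) :
    KernelSymmetric n f g := fun z hz w hw => by
  have h1 := add_conj_ne_zero_of_nonneg hA hz
  have h2 : conj w + A ≠ 0 := fun h0 =>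
    add_conj_ne_zero_of_nonneg hA hw (by simpa using congrArg conj h0)
  rw [(h z hz).1, (h w hw).1, (h z hz).2, (h w hw).2]
  simp only [map_div₀, map_pow, map_add, Complex.conj_conj, Complex.conj_ofReal]
  rw [div_mul_eq_mul_div, div_mul_eq_mul_div, div_eq_div_iff (pow_ne_zero _ h1)
    (pow_ne_zero _ h2), mul_assoc, mul_assoc, ← mul_pow, ← mul_pow]
  congr 2
  field_simp
  ring

/-- This is what the change of variables needs: with s = |z + conj A|, |f|² and |g'|² are constant
multiples of s^(-2ℓ-4) and s^(-4), so their ratio leaves (Re z / s²)^ℓ to be bounded by a multiple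
of (Re g)^ℓ. -/
theorem exists_re_div_le {A : ℂ} {b : ℝ} (hb : b ≠ 0) (hA : 0 ≤ A.re)
    (hbA : b < 0 → 0 < A.re ∧ -b ≤ A.re ^ 2) :
    ∃ K : ℝ, 0 ≤ K ∧ ∀ z ∈ rightHalfPlane,
      z.re / ‖z + conj A‖ ^ 2 ≤ K * (A + b / (z + conj A)).re := by
  have hre : ∀ z ∈ rightHalfPlane, 0 < ‖z + conj A‖ ^ 2 ∧ (A + b / (z + conj A)).re =
      (A.re * ‖z + conj A‖ ^ 2 + b * (z.re + A.re)) / ‖z + conj A‖ ^ 2 := by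
    intro z hz
    have h1 : 0 < ‖z + conj A‖ ^ 2 := by
      have := norm_pos_iff.mpr (add_conj_ne_zero_of_nonneg hA hz)
      positivity
    refine ⟨h1, ?_⟩
    rw [Complex.add_re, Complex.div_re, Complex.normSq_eq_norm_sq]
    simp only [Complex.ofReal_re, Complex.ofReal_im, Complex.add_re, Complex.conj_re]
    have h2 := h1.ne'
    generalize ‖z + conj A‖ ^ 2 = s at h2
    field_simp
    ring
  rcases lt_or_gt_of_ne hb with hb0 | hb0
  · obtain ⟨hA', hbA'⟩ := hbA hb0
    refine ⟨1 / A.re ^ 2, by positivity, fun z hz => ?_⟩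
    obtain ⟨hs, h2⟩ := hre z hz
    have hz' : 0 < z.re := hz
    rw [h2, ← mul_div_assoc]
    refine div_le_div_of_nonneg_right ?_ hs.le
    rw [one_div, inv_mul_eq_div, le_div_iff₀ (by positivity)]
    -- With x = Re z and r = Re A: r s² + b (x + r) ≥ (x + r)(r (x + r) - r²) = (x + r) r x ≥ r² x,
    -- which explains the constant 1/r².
    have h3 : (z.re + A.re) ^ 2 ≤ ‖z + conj A‖ ^ 2 := by
      rw [← Complex.normSq_eq_norm_sq, Complex.normSq_apply]
      simp only [Complex.add_re, Complex.conj_re]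
      nlinarith [mul_self_nonneg (z + conj A).im]
    nlinarith [mul_le_mul_of_nonneg_left h3 hA, mul_pos hz' hA', mul_pos (mul_pos hz' hz') hA',
      mul_nonneg (by linarith : 0 ≤ b + A.re ^ 2) (by linarith : 0 ≤ z.re + A.re)]
  -- For b > 0 the term b · Re z of the numerator suffices.
  · refine ⟨1 / b, by positivity, fun z hz => ?_⟩
    obtain ⟨hs, h2⟩ := hre z hz
    rw [h2, ← mul_div_assoc]
    refine div_le_div_of_nonneg_right ?_ hs.le
    rw [one_div, inv_mul_eq_div, le_div_iff₀ hb0]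
    nlinarith [mul_nonneg hA hs.le, mul_nonneg hA hb0.le]

theorem isBoundedOperator_of_moebius {ℓ : ℕ} {f g : ℂ → ℂ} {A : ℂ} {b c : ℝ}
    (hf : DifferentiableOn ℂ f rightHalfPlane)
    (hmaps : MapsTo g rightHalfPlane rightHalfPlane) (hb : b ≠ 0) (hA : 0 ≤ A.re)
    (hbA : b < 0 → 0 < A.re ∧ -b ≤ A.re ^ 2)
    (hfg : ∀ w ∈ rightHalfPlane,
      g w = A + b / (w + conj A) ∧ f w = (c : ℂ) / (w + conj A) ^ (ℓ + 2)) :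
    IsBoundedOperator (maxWeightedComp ℓ f g) := by
  obtain ⟨K, hK, hKz⟩ := exists_re_div_le hb hA hbA
  have hb' : (b : ℂ) ≠ 0 := Complex.ofReal_ne_zero.mpr hb
  refine isBoundedOperator_of_injOn (g' := fun z => -b / (z + conj A) ^ 2) hf (fun z hz => ?_)
    hmaps (fun z hz w hw h => ?_) (C := K ^ ℓ * c ^ 2 / b ^ 2) (by positivity) fun z hz => ?_
  · have h1 : HasDerivAt (fun w : ℂ => A + b / (w + conj A)) (-b / (z + conj A) ^ 2) z := by
      have h2 := ((hasDerivAt_const z (b : ℂ)).div ((hasDerivAt_id z).add_const (conj A))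
        (add_conj_ne_zero_of_nonneg hA hz)).const_add A
      convert! h2 using 1
      simp
    exact h1.congr_of_eventuallyEq (eventually_of_mem
      (BergmanSpace.isOpen_rightHalfPlane.mem_nhds hz) fun w hw => (hfg w hw).1)
  · rw [(hfg z hz).1, (hfg w hw).1, add_right_inj,
      div_eq_div_iff (add_conj_ne_zero_of_nonneg hA hz) (add_conj_ne_zero_of_nonneg hA hw)] at h
    exact (add_right_cancel (mul_left_cancel₀ hb' h)).symm
  · have hz' : 0 < z.re := hz
    have h1 := hKz z hz
    rw [← (hfg z hz).1] at h1
    have h2 := norm_pos_iff.mpr (add_conj_ne_zero_of_nonneg hA hz)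
    have h3 := pow_le_pow_left₀ (by positivity) h1 ℓ
    rw [(hfg z hz).2, norm_div, norm_pow, norm_div, norm_pow, norm_neg, Complex.norm_real,
      Complex.norm_real, div_pow, div_pow, Real.norm_eq_abs, Real.norm_eq_abs, sq_abs, sq_abs]
    generalize ‖z + conj A‖ = s at *
    calc _ = (z.re / s ^ 2) ^ ℓ * (c ^ 2 / s ^ 4) := by
          rw [div_pow]
          field_simp
          ring
      _ ≤ (K * (g z).re) ^ ℓ * (c ^ 2 / s ^ 4) := by gcongr
      _ = _ := by
          rw [mul_pow]
          field_simp

/-! ### Reparametrization and the theorem -/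

/-- The two parametrizations of the Möbius family of symbols. -/
theorem moebius_symbols_iff {n : ℕ} {f g : ℂ → ℂ} :
    (∃ (α δ : ℝ) (β : ℂ), α ≠ 0 ∧ δ ≠ 0 ∧
      ((β.re < 0 ∧ 0 < α ∧ α ≤ β.re ^ 2 / 2) ∨ (α < 0 ∧ 0 ≤ β.re)) ∧
      ∀ w ∈ rightHalfPlane,
        g w = -(β / (α : ℂ)) - 2 / ((α : ℂ) * w - conj β) ∧
        f w = (δ : ℂ) / ((α : ℂ) * w - conj β) ^ n) ↔
    ∃ (A : ℂ) (b c : ℝ), b ≠ 0 ∧ c ≠ 0 ∧ 0 ≤ A.re ∧ (b < 0 → 0 < A.re ∧ -b ≤ A.re ^ 2) ∧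
      ∀ w ∈ rightHalfPlane,
        g w = A + b / (w + conj A) ∧ f w = (c : ℂ) / (w + conj A) ^ n := by
  constructor
  · rintro ⟨α, δ, β, hα, hδ, hcase, h⟩
    have hα' : (α : ℂ) ≠ 0 := Complex.ofReal_ne_zero.mpr hα
    have hre : (-(β / (α : ℂ))).re = -β.re / α := by
      rw [Complex.neg_re, Complex.div_ofReal_re, neg_div]
    have hden : ∀ w : ℂ, (α : ℂ) * w - conj β = α * (w + conj (-(β / (α : ℂ)))) := by
      intro w
      simp only [map_neg, map_div₀, Complex.conj_ofReal]
      field_simp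
      ring
    -- Obtained by factoring α out of α w - conj β. The sign of b is opposite to that of α, and -b ≤
    -- (Re A)² becomes α ≤ (Re β)²/2.
    refine ⟨-(β / α), -2 / α, δ / α ^ n, div_ne_zero (by norm_num) hα,
      div_ne_zero hδ (pow_ne_zero _ hα), ?_, fun hb => ?_, fun w hw => ?_⟩
    · rw [hre]
      rcases hcase with ⟨h1, h2, -⟩ | ⟨h1, h2⟩
      · exact div_nonneg (by linarith) h2.le
      · exact div_nonneg_of_nonpos (by linarith) h1.le
    · rw [hre]
      rcases hcase with ⟨h1, h2, h3⟩ | ⟨h1, h2⟩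
      · refine ⟨div_pos (by linarith) h2, ?_⟩
        rw [← neg_div, neg_neg, div_pow, neg_sq, div_le_div_iff₀ h2 (by positivity)]
        nlinarith
      · exact absurd hb (not_lt.mpr (div_nonneg_of_nonpos (by norm_num) h1.le))
    · obtain ⟨hg, hf⟩ := h w hw
      rw [hden] at hg hf
      push_cast
      refine ⟨?_, ?_⟩
      · rw [hg, div_div, neg_div, sub_eq_add_neg]
      · rw [hf, mul_pow, div_div]
  · rintro ⟨A, b, c, hb, hc, hA, hbA, h⟩
    have hb' : (b : ℂ) ≠ 0 := Complex.ofReal_ne_zero.mpr hb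
    have hα : -2 / b ≠ 0 := div_ne_zero (by norm_num) hb
    have hre : (2 * A / (b : ℂ)).re = 2 * A.re / b := by
      rw [Complex.div_ofReal_re]
      simp
    have hden : ∀ w : ℂ, ((-2 / b : ℝ) : ℂ) * w - conj (2 * A / (b : ℂ)) =
        ((-2 / b : ℝ) : ℂ) * (w + conj A) := by
      intro w
      simp only [map_div₀, map_mul, Complex.conj_ofReal, Complex.conj_ofNat]
      push_cast
      ring
    refine ⟨-2 / b, c * (-2 / b) ^ n, 2 * A / b, hα, mul_ne_zero hc (pow_ne_zero _ hα), ?_,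
      fun w hw => ?_⟩
    · rw [hre]
      rcases lt_or_gt_of_ne hb with hb0 | hb0
      · obtain ⟨h1, h2⟩ := hbA hb0
        refine Or.inl ⟨div_neg_of_pos_of_neg (by linarith) hb0,
          div_pos_of_neg_of_neg (by norm_num) hb0, ?_⟩
        rw [div_pow, div_div, ← sub_nonneg,
          show (2 * A.re) ^ 2 / (b ^ 2 * 2) - -2 / b = 2 * (A.re ^ 2 + b) / b ^ 2 by
            field_simp
            ring]
        exact div_nonneg (by linarith) (sq_nonneg _)
      · exact Or.inr ⟨div_neg_of_neg_of_pos (by norm_num) hb0,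
          div_nonneg (by linarith) hb0.le⟩
    · obtain ⟨hg, hf⟩ := h w hw
      have hα' : (((-2 / b : ℝ) : ℂ)) ≠ 0 := Complex.ofReal_ne_zero.mpr hα
      rw [hden, hg, hf, mul_pow]
      push_cast at hα' ⊢
      refine ⟨?_, ?_⟩
      · rw [show -(2 * A / (b : ℂ) / (-2 / b)) = A by field_simp, sub_eq_add_neg, ← div_div,
          ← neg_div]
        congr 2
        field_simp
      · rw [mul_comm (c : ℂ), mul_div_mul_left _ _ (pow_ne_zero _ hα')]

theorem mainTheorem1 (ℓ : ℕ) (f g : ℂ → ℂ)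
    (hf : DifferentiableOn ℂ f rightHalfPlane) (hg : DifferentiableOn ℂ g rightHalfPlane)
    (hmaps : MapsTo g rightHalfPlane rightHalfPlane) :
    (IsSelfAdjoint (maxWeightedComp ℓ f g) ↔
      (∀ w ∈ rightHalfPlane, f w = 0) ∨
      (∃ (μ : ℂ) (ε : ℝ), μ ∈ rightHalfPlane ∧
        ∀ w ∈ rightHalfPlane, g w = μ ∧ f w = (ε : ℂ) / (w + conj μ) ^ (ℓ + 2)) ∨
      (∃ γ lam : ℝ, 0 ≤ γ ∧ ∀ w ∈ rightHalfPlane, g w = w + (γ : ℂ) ∧ f w = (lam : ℂ)) ∨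
      (∃ (α δ : ℝ) (β : ℂ), α ≠ 0 ∧ δ ≠ 0 ∧
        ((β.re < 0 ∧ 0 < α ∧ α ≤ β.re ^ 2 / 2) ∨ (α < 0 ∧ 0 ≤ β.re)) ∧
        ∀ w ∈ rightHalfPlane,
          g w = -(β / (α : ℂ)) - 2 / ((α : ℂ) * w - conj β) ∧
          f w = (δ : ℂ) / ((α : ℂ) * w - conj β) ^ (ℓ + 2))) ∧
    (IsSelfAdjoint (maxWeightedComp ℓ f g) → IsBoundedOperator (maxWeightedComp ℓ f g)) := by
  rw [moebius_symbols_iff]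
  -- Boundedness is proved from the explicit symbols, so it reaches hermitian operators only through
  -- the classification.
  have hlogic : ∀ {S P B : Prop}, (S → P) → (P → S ∧ B) → (S ↔ P) ∧ (S → B) := by tauto
  refine hlogic (fun hT => KernelSymmetric.classification (by omega) hf hg hmaps
    (hT.kernelSymmetric hmaps)) fun h => ?_
  suffices hsb : KernelSymmetric (ℓ + 2) f g ∧ IsBoundedOperator (maxWeightedComp ℓ f g) from
    ⟨hsb.1.isSelfAdjoint hmaps hsb.2, hsb.2⟩
  rcases h with h | ⟨μ, ε, hμ, h⟩ | ⟨γ, lam, hγ, h⟩ | ⟨A, b, c, hb, -, hA, hbA, h⟩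
  · exact ⟨kernelSymmetric_of_eq_zero h, isBoundedOperator_of_eq_zero hf hg hmaps h⟩
  · exact ⟨kernelSymmetric_of_const hμ h, isBoundedOperator_of_const hf hg hmaps hμ h⟩
  · exact ⟨kernelSymmetric_of_translation h, isBoundedOperator_of_translation hf hmaps hγ h⟩
  · exact ⟨kernelSymmetric_of_moebius hA h, isBoundedOperator_of_moebius hf hmaps hb hA hbA h⟩
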